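/- Let $F$ be a non-archimedean local field with ring of integers $R$, uniformizer $\pi$, residue field of $q$ elements and residual characteristic $\neq 2$. Let $\psi:F\to\mathbb C^\times$ be an additive character that is trivial on $R$ but not on $\pi^{-1}R$. Let $dx$ be the Haar measure on $F$ with $\int_R dx=1$ and $d^\times\alpha$ the Haar measure on $F^\times$ with $\int_{R^\times}d^\times\alpha=1$. Let $\theta\in R^\times$ be a non-square (the non-split case). Let $J$ be the $5\times5$ matrix with $1$'s on the antidiagonal and $0$'s elsewhere, and let $K=\{k\in SL(5,R):{}^tkJk=J\}$, acting on column vectors in $F^5$. For $x_1,x_2,x_3\in F$ and $\alpha\in F^\times$ put $$n(x_1,x_2,x_3)=\begin{pmatrix}1&-x_3&-x_2&-x_1&-x_1x_3-\tfrac12x_2^2\\0&1&0&0&x_1\\0&0&1&0&x_2\\0&0&0&1&x_3\\0&0&0&0&1\end{pmatrix},\qquad \gamma_0=\begin{pmatrix}1&1&0&0&0\\-1&0&0&0&0\\0&0&1&0&0\\0&0&0&1&-1\\0&0&0&1&0\end{pmatrix},$$ $a_\alpha=\mathrm{diag}(\alpha,1,1,1,\alpha^{-1})$, $v_0={}^t(0,2\theta,0,1,0)$,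 $v_1=\gamma_0v_0={}^t(2\theta,0,0,1,1)$ and $d_i=a_{\pi^i}$. Let $\phi_i$ be the characteristic function of the orbit $Kd_iv_1$ and $\Phi_r=\sum_{i=0}^r\phi_i$. Define $$\Psi(\alpha,\Phi_r)=\int_F\int_F\int_F\Phi_r\bigl(n(x_1,x_2,x_3)\,a_\alpha\gamma_0v_0\bigr)\,\psi(x_1+2\theta x_3)\,dx_1\,dx_2\,dx_3 .$$ Proposition 3.6. Let $r\ge 1$ and let $\chi:F^\times\to\mathbb C^\times$ be a continuous character. Then the integral defining $\Psi(\alpha,\Phi_r)$ converges absolutely for every $\alpha\in F^\times$, the Mellin transform $$\widehat\Psi_r(\chi)=\int_{F^\times}\Psi(\alpha,\Phi_r)\,\chi(\alpha)\,d^\times\alpha$$ converges absolutely, and $$\widehat\Psi_r(\chi)=X^{-r}-qX^{1-r}\quad\text{with } X=\chi(\pi)^{-1}$$ if $\chi$ is unramified (trivial on $R^\times$), while $\widehat\Psi_r(\chi)=0$ if $\chi$ is ramified (not trivial on $R^\times$). -/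

import Mathlib

open MeasureTheory ValuativeRel
open scoped Matrix Valued

namespace SOFive

/-- The antidiagonal matrix `J` with ones on the antidiagonal. -/
def J (A : Type*) [CommRing A] : Matrix (Fin 5) (Fin 5) A :=
  !![0, 0, 0, 0, 1;
     0, 0, 0, 1, 0;
     0, 0, 1, 0, 0;
     0, 1, 0, 0, 0;
     1, 0, 0, 0, 0]

/-- The split special orthogonal group `SO(3,2; A) = {g ∈ SL(5, A) : ᵗg J g = J}`. -/
def SO32 (A : Type*) [CommRing A] : Subgroup (Matrix.SpecialLinearGroup (Fin 5) A) where
  carrier := {g | (g : Matrix (Fin 5) (Fin 5) A)ᵀ * J A * (g : Matrix (Fin 5) (Fin 5) A) = J A}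
  one_mem' := by simp
  mul_mem' := by
    intro a b ha hb
    simp only [Set.mem_ofPred_eq, Matrix.SpecialLinearGroup.coe_mul, Matrix.transpose_mul] at *
    calc _ = (b : Matrix (Fin 5) (Fin 5) A)ᵀ *
          ((a : Matrix (Fin 5) (Fin 5) A)ᵀ * J A * (a : Matrix (Fin 5) (Fin 5) A)) *
          (b : Matrix (Fin 5) (Fin 5) A) := by simp only [Matrix.mul_assoc]
      _ = J A := by rw [ha, hb]
  inv_mem' := by
    intro a ha
    simp only [Set.mem_ofPred_eq] at *
    have h1 : (a : Matrix (Fin 5) (Fin 5) A) * ((a⁻¹ : Matrix.SpecialLinearGroup (Fin 5) A) :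
        Matrix (Fin 5) (Fin 5) A) = 1 := by
      rw [← Matrix.SpecialLinearGroup.coe_mul, mul_inv_cancel, Matrix.SpecialLinearGroup.coe_one]
    have h2 : ((a⁻¹ : Matrix.SpecialLinearGroup (Fin 5) A) : Matrix (Fin 5) (Fin 5) A)ᵀ *
        (a : Matrix (Fin 5) (Fin 5) A)ᵀ = 1 := by
      rw [← Matrix.transpose_mul, h1, Matrix.transpose_one]
    conv_lhs => rw [← ha]
    simp only [Matrix.mul_assoc, h1, Matrix.mul_one]
    simp only [← Matrix.mul_assoc, h2, Matrix.one_mul]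

section Field

variable {F : Type*} [Field F]

/-- The element `n(x₁, x₂, x₃)` of the unipotent radical `N ≅ F³`. -/
def nMat (x₁ x₂ x₃ : F) : Matrix (Fin 5) (Fin 5) F :=
  !![1, -x₃, -x₂, -x₁, -x₁ * x₃ - x₂ ^ 2 / 2;
     0, 1, 0, 0, x₁;
     0, 0, 1, 0, x₂;
     0, 0, 0, 1, x₃;
     0, 0, 0, 0, 1]

/-- The element `a_α = diag(α, 1, 1, 1, α⁻¹)`. -/
def aMat (α : Fˣ) : Matrix (Fin 5) (Fin 5) F :=
  Matrix.diagonal ![(α : F), 1, 1, 1, ((α⁻¹ : Fˣ) : F)]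

/-- The representative `γ₀` in the non-split case. -/
def γ₀ (F : Type*) [Field F] : Matrix (Fin 5) (Fin 5) F :=
  !![1, 1, 0, 0, 0;
     -1, 0, 0, 0, 0;
     0, 0, 1, 0, 0;
     0, 0, 0, 1, -1;
     0, 0, 0, 1, 0]

/-- The base point `v₀` in the non-split case. -/
def v₀ (θ : F) : Fin 5 → F := ![0, 2 * θ, 0, 1, 0]

/-- The vector `v₁` in the non-split case; it is equal to `γ₀ v₀`. -/
def v₁ (θ : F) : Fin 5 → F := ![2 * θ, 0, 0, 1, 1]

/-- The orbital integral `Ψ(α, φ) = ∫_N φ(n a_α γ₀ v₀) ψ_N(n) dn` with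
`ψ_N(n(x₁, x₂, x₃)) = ψ(x₁ + 2 θ x₃)` and `dn = dx₁ dx₂ dx₃`. -/
noncomputable def orbInt [MeasurableSpace F] (μ : Measure F) (ψ : AddChar F ℂ) (θ : F)
    (φ : (Fin 5 → F) → ℂ) (α : Fˣ) : ℂ :=
  ∫ x : F × F × F, φ ((nMat x.1 x.2.1 x.2.2 * aMat α * γ₀ F) *ᵥ v₀ θ) *
    ψ (x.1 + 2 * θ * x.2.2) ∂(μ.prod (μ.prod μ))

end Field

section LocalField

variable {F : Type*} [Field F] [ValuativeRel F]

/-- `ϖ` is a generator of the maximal ideal of the ring of integers. -/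
def IsUniformizer (ϖ : Fˣ) : Prop :=
  ∃ p : 𝒪[F], (p : F) = ϖ ∧ 𝓂[F] = Ideal.span {p}

/-- The unit group `R^×` of the ring of integers `R`, as a set of elements of `F^×`. -/
def integerUnits (F : Type*) [Field F] [ValuativeRel F] : Set Fˣ :=
  {u | valuation F (u : F) = 1}

/-- `ψ` has conductor `R`: it is trivial on `R` but not on `ϖ⁻¹ R`. -/
def HasConductorIntegers (ψ : AddChar F ℂ) (ϖ : Fˣ) : Prop :=
  (∀ x : F, x ∈ 𝒪[F] → ψ x = 1) ∧ ∃ x : F, x ∈ 𝒪[F] ∧ ψ (((ϖ⁻¹ : Fˣ) : F) * x) ≠ 1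

/-- `χ` is unramified: it is trivial on `R^×`. -/
def IsUnramified (χ : Fˣ →* ℂˣ) : Prop := ∀ u ∈ integerUnits F, χ u = 1

/-- The orbit `K v`, where `K = SO(3,2; R)`. -/
def orbitK (v : Fin 5 → F) : Set (Fin 5 → F) :=
  {w | ∃ k ∈ SO32 𝒪[F], w = (k : Matrix (Fin 5) (Fin 5) 𝒪[F]).map (algebraMap 𝒪[F] F) *ᵥ v}

/-- The characteristic function `φ_r` of the orbit `K d_r v₁`, where
`d_r = diag(ϖ ^ r, 1, 1, 1, ϖ ^ (-r))`. -/
noncomputable def φ (ϖ : Fˣ) (θ : F) (r : ℕ) : (Fin 5 → F) → ℂ :=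
  (orbitK (aMat (ϖ ^ r) *ᵥ v₁ θ)).indicator 1

/-- `Φ_r = φ_0 + φ_1 + ⋯ + φ_r`. -/
noncomputable def Φ (ϖ : Fˣ) (θ : F) (r : ℕ) : (Fin 5 → F) → ℂ :=
  ∑ i ∈ Finset.range (r + 1), φ ϖ θ i

end LocalField

end SOFive

/-!
As `K` is transitive on the primitive vectors of `R⁵` with a given value of `ᵗw J w`, the orbit
`K d_i v₁` is the set of `w` with `ᵗw J w = 4 θ` and sup norm `|ϖ| ^ (-i)`. So for `α = b ϖ ^ r`
the function `n ↦ Φ_r (n a_α γ₀ v₀)` is, after the shift `x₃ ↦ x₃ + α`, the indicator of a compact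
region on which all coordinates are at most `|b|`. For `|b| < 1` it is empty and for `|b| = 1` it
is `R³`. For `|b| > 1`, integrating over `x₁` forces `|x₃| = |b|`, and the substitution
`x₂ = z x₃` turns what is left into `vol (b R)` times the average over `z ∈ R` of
`∫_{|y| = |b|} ψ ((2 θ - z² / 2) y + c / y) dy`, where `c = 2 θ α²`. As `θ` is not a square,
`2 θ - z² / 2` is a unit by Hensel's lemma, so the linear phase dominates and the inner integral
is `-1` if `|b| = |ϖ|⁻¹` and `0` beyond. Hence `Ψ(·, Φ_r)` is `1` on `ϖ ^ r R^×`, `-q` on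
`ϖ ^ (r - 1) R^×` and `0` elsewhere.
-/

namespace SOFive

section LocalField

variable (F : Type*) [Field F] [ValuativeRel F] [TopologicalSpace F] [IsNonarchimedeanLocalField F]

theorem t2Space : T2Space F := by
  let := IsTopologicalAddGroup.rightUniformSpace F
  have := isUniformAddGroup_of_addCommGroup (G := F)
  exact inferInstance

theorem secondCountableTopology : SecondCountableTopology F := by
  let := IsTopologicalAddGroup.rightUniformSpace F
  have := isUniformAddGroup_of_addCommGroup (G := F)
  let : (Valued.v (R := F)).RankOne :=
  { hom' := IsRankLeOne.nonempty.some.emb (R := F).comp MonoidWithZeroHom.ValueGroup₀.embedding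
    strictMono' := IsRankLeOne.nonempty.some.strictMono.comp
        MonoidWithZeroHom.ValueGroup₀.embedding_strictMono }
  have : ProperSpace F := .of_nontriviallyNormedField_of_weaklyLocallyCompactSpace F
  exact secondCountable_of_proper

theorem henselianLocalRing : HenselianLocalRing 𝒪[F] := by
  let := IsTopologicalAddGroup.rightUniformSpace F
  have := isUniformAddGroup_of_addCommGroup (G := F)
  have : HenselianRing (valuation F).integer
    (IsLocalRing.maximalIdeal (valuation F).integer) := inferInstance
  exact ⟨fun f hf a₀ h₁ h₂ => this.is_henselian f hf a₀ h₁ (h₂.map _)⟩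

end LocalField

section Valuation

variable {F : Type*} [Field F] [ValuativeRel F]

theorem isUnit_integer_iff {x : 𝒪[F]} : IsUnit x ↔ valuation F (x : F) = 1 :=
  (Valuation.integer.integers (valuation F)).isUnit_iff_valuation_eq_one

theorem mem_maximalIdeal_integer_iff {x : 𝒪[F]} : x ∈ 𝓂[F] ↔ valuation F (x : F) < 1 := by
  rw [IsLocalRing.mem_maximalIdeal, mem_nonunits_iff, isUnit_integer_iff]
  exact (lt_iff_le_and_ne.trans (and_iff_right x.2)).symm

theorem isUnit_two_integer (hchar : ringChar 𝓀[F] ≠ 2) : IsUnit (2 : 𝒪[F]) := by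
  rw [← IsLocalRing.notMem_maximalIdeal, ← IsLocalRing.residue_eq_zero_iff, map_ofNat]
  exact Ring.two_ne_zero hchar

theorem valuation_pos {x : F} (hx : x ≠ 0) : 0 < valuation F x :=
  zero_lt_iff.2 ((valuation F).ne_zero_iff.2 hx)

theorem ne_zero_of_valuation_eq {x b : F} (hb : b ≠ 0) (h : valuation F x = valuation F b) :
    x ≠ 0 := by
  rwa [← (valuation F).ne_zero_iff, h, (valuation F).ne_zero_iff]

namespace IsUniformizer

variable {ϖ : Fˣ}

theorem valuation_lt_one (hϖ : IsUniformizer ϖ) : valuation F (ϖ : F) < 1 := by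
  obtain ⟨p, hp, hm⟩ := hϖ
  rw [← hp, ← mem_maximalIdeal_integer_iff, hm]
  exact Ideal.mem_span_singleton_self p

theorem one_lt_valuation_inv (hϖ : IsUniformizer ϖ) : 1 < valuation F (ϖ : F)⁻¹ := by
  rw [map_inv₀]
  exact (one_lt_inv₀ (valuation_pos ϖ.ne_zero)).2 hϖ.valuation_lt_one

theorem valuation_le_of_lt_one (hϖ : IsUniformizer ϖ) {x : F} (hx : valuation F x < 1) :
    valuation F x ≤ valuation F (ϖ : F) := by
  obtain ⟨p, hp, hm⟩ := hϖ
  have hxm : (⟨x, hx.le⟩ : 𝒪[F]) ∈ 𝓂[F] := mem_maximalIdeal_integer_iff.2 hx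
  rw [hm, Ideal.mem_span_singleton] at hxm
  obtain ⟨y, hy⟩ := hxm
  rw [show x = p * (y : F) from congrArg Subtype.val hy, map_mul, hp]
  exact mul_le_of_le_one_right' y.2

theorem valuation_le_mul_of_lt (hϖ : IsUniformizer ϖ) {x y : F}
    (hxy : valuation F x < valuation F y) :
    valuation F x ≤ valuation F (ϖ : F) * valuation F y := by
  have hy : 0 < valuation F y := zero_le.trans_lt hxy
  rw [← div_le_iff₀ hy, ← map_div₀]
  exact hϖ.valuation_le_of_lt_one (by rwa [map_div₀, div_lt_one₀ hy])

theorem valuation_inv_le_of_one_lt (hϖ : IsUniformizer ϖ) {b : F} (hb : 1 < valuation F b) :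
    valuation F (ϖ : F)⁻¹ ≤ valuation F b := by
  rw [map_inv₀, inv_le_iff_one_le_mul₀' (valuation_pos ϖ.ne_zero)]
  simpa using hϖ.valuation_le_mul_of_lt (x := 1) (y := b) (by simpa using hb)

theorem exists_valuation_eq_pow [IsDiscreteValuationRing 𝒪[F]] (hϖ : IsUniformizer ϖ) {x : F}
    (hx : valuation F x ≤ 1) (hx₀ : x ≠ 0) : ∃ n : ℕ, valuation F x = valuation F (ϖ : F) ^ n := by
  obtain ⟨p, hp, hm⟩ := hϖ
  have hp' : Irreducible p := (IsDiscreteValuationRing.irreducible_iff_uniformizer p).2 hm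
  obtain ⟨n, u, hu⟩ := IsDiscreteValuationRing.eq_unit_mul_pow_irreducible
    (x := (⟨x, hx⟩ : 𝒪[F])) (by simpa [Subtype.ext_iff] using hx₀) hp'
  refine ⟨n, ?_⟩
  rw [show x = (u : 𝒪[F]) * (p : F) ^ n from congrArg Subtype.val hu, map_mul, map_pow, hp,
    isUnit_integer_iff.1 u.isUnit, one_mul]

end IsUniformizer

theorem isSquare_of_valuation_sq_sub_lt_one [HenselianLocalRing 𝒪[F]] (h2 : IsUnit (2 : 𝒪[F]))
    {θ z : F} (hθ : valuation F θ = 1)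
    (hz : valuation F (z ^ 2 - θ) < 1) : IsSquare θ := by
  have hz₁ : valuation F z = 1 := by
    have hz2 : valuation F (z ^ 2) = 1 := by
      rw [← hθ]
      exact (valuation F).map_eq_of_sub_lt (by rwa [hθ])
    rwa [map_pow, pow_eq_one_iff_of_nonneg zero_le two_ne_zero] at hz2
  obtain ⟨a, ha, -⟩ := HenselianLocalRing.is_henselian
    (Polynomial.X ^ 2 - Polynomial.C (⟨θ, hθ.le⟩ : 𝒪[F]))
    (Polynomial.monic_X_pow_sub_C _ two_ne_zero) ⟨z, hz₁.le⟩
    (mem_maximalIdeal_integer_iff.2 (by simpa using hz))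
    (by simpa [one_add_one_eq_two] using
      And.intro h2 (isUnit_integer_iff (x := ⟨z, hz₁.le⟩).2 hz₁))
  have ha' : a ^ 2 - (⟨θ, hθ.le⟩ : 𝒪[F]) = 0 := by simpa [Polynomial.IsRoot] using ha
  exact ⟨a, by rw [← pow_two]; exact (sub_eq_zero.1 (congrArg Subtype.val ha')).symm⟩

theorem valuation_two_mul_sub_sq_div_two [HenselianLocalRing 𝒪[F]] (h2 : IsUnit (2 : 𝒪[F]))
    {θ : F} (hθ : valuation F θ = 1) (hθ' : ¬ IsSquare θ) {z : F} (hz : valuation F z ≤ 1) :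
    valuation F (2 * θ - z ^ 2 / 2) = 1 := by
  have hv2 : valuation F (2 : F) = 1 := isUnit_integer_iff.1 h2
  have h20 : (2 : F) ≠ 0 := ne_zero_of_valuation_eq one_ne_zero (by rw [hv2, map_one])
  have hle : valuation F (2 * θ - z ^ 2 / 2) ≤ 1 :=
    (valuation F).map_sub_le (by simp [hv2, hθ]) (by simpa [hv2] using pow_le_one₀ zero_le hz)
  refine hle.antisymm (not_lt.1 fun hlt => hθ' ?_)
  refine isSquare_of_valuation_sq_sub_lt_one h2 (z := z / 2) hθ ?_
  rwa [show (z / 2) ^ 2 - θ = -((2 * θ - z ^ 2 / 2) / 2) by field_simp; ring, Valuation.map_neg,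
    map_div₀, hv2, div_one]

end Valuation

section Witt

variable {A : Type*} [CommRing A]

/-- The quadratic form `ᵗv J v` preserved by `SO32 A`. -/
def quadForm (v : Fin 5 → A) : A := v ⬝ᵥ (J A *ᵥ v)

theorem quadForm_eq (v : Fin 5 → A) :
    quadForm v = 2 * v 0 * v 4 + 2 * v 1 * v 3 + v 2 ^ 2 := by
  simp only [quadForm, J, dotProduct, Matrix.mulVec, Fin.sum_univ_five, Matrix.of_apply,
    Matrix.cons_val]
  ring

theorem quadForm_smul (c : A) (v : Fin 5 → A) : quadForm (c • v) = c ^ 2 * quadForm v := by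
  simp only [quadForm_eq, Pi.smul_apply, smul_eq_mul]
  ring

theorem quadForm_comp_ringHom {B : Type*} [CommRing B] (f : A →+* B) (v : Fin 5 → A) :
    quadForm (f ∘ v) = f (quadForm v) := by
  simp [quadForm_eq, map_ofNat]

theorem quadForm_smul_of_mem_SO32 (g : SO32 A) (v : Fin 5 → A) : quadForm (g • v) = quadForm v := by
  obtain ⟨g, hg⟩ := g
  change quadForm (g.1 *ᵥ v) = quadForm v
  unfold quadForm
  conv_rhs => rw [← show g.1ᵀ * J A * g.1 = J A from hg]
  rw [← Matrix.mulVec_mulVec, ← Matrix.mulVec_mulVec, Matrix.dotProduct_mulVec v,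
    Matrix.vecMul_transpose]

theorem exists_isUnit_smul_apply [IsLocalRing A] (g : SO32 A) {v : Fin 5 → A}
    (hv : ∃ i, IsUnit (v i)) : ∃ i, IsUnit ((g • v) i) := by
  by_contra! hgv
  obtain ⟨i, hi⟩ := hv
  refine (IsLocalRing.mem_maximalIdeal _).1 ?_ hi
  rw [← inv_smul_smul g v]
  exact Ideal.sum_mem _ fun j (_ : j ∈ Finset.univ) =>
    Ideal.mul_mem_left _ ((g⁻¹).1.1 i j) ((IsLocalRing.mem_maximalIdeal _).2 (hgv j))

theorem mem_orbit_trans {G X : Type*} [Group G] [MulAction G X] {x y z : X}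
    (hy : y ∈ MulAction.orbit G x) (hz : z ∈ MulAction.orbit G y) : z ∈ MulAction.orbit G x :=
  MulAction.orbit_eq_iff.2 hy ▸ hz

theorem mulVec_mem_orbit_SO32 {g : Matrix (Fin 5) (Fin 5) A} (hdet : g.det = 1)
    (hg : gᵀ * J A * g = J A) (v : Fin 5 → A) : g *ᵥ v ∈ MulAction.orbit (SO32 A) v :=
  ⟨⟨⟨g, hdet⟩, hg⟩, rfl⟩

theorem swap_outer_mem_orbit (v : Fin 5 → A) :
    ![v 4, v 3, v 2, v 1, v 0] ∈ MulAction.orbit (SO32 A) v := by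
  convert mulVec_mem_orbit_SO32 (g := J A) ?_ ?_ v using 1
  · ext i; fin_cases i <;> simp [J, Matrix.mulVec, dotProduct, Fin.sum_univ_five]
  · simp [J, Matrix.det_succ_row_zero, Fin.sum_univ_succ, Fin.succAbove]
    ring
  · ext i j; fin_cases i <;> fin_cases j <;> simp [J, Matrix.mul_apply, Fin.sum_univ_five]

theorem swap_inner_mem_orbit (v : Fin 5 → A) :
    ![v 1, v 0, v 2, v 4, v 3] ∈ MulAction.orbit (SO32 A) v := by
  convert mulVec_mem_orbit_SO32 (g := !![0, 1, 0, 0, 0; 1, 0, 0, 0, 0; 0, 0, 1, 0, 0;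
    0, 0, 0, 0, 1; 0, 0, 0, 1, 0]) ?_ ?_ v using 1
  · ext i; fin_cases i <;> simp [Matrix.mulVec, dotProduct, Fin.sum_univ_five]
  · simp [Matrix.det_succ_row_zero, Fin.sum_univ_succ, Fin.succAbove]
  · ext i j; fin_cases i <;> fin_cases j <;> simp [J, Matrix.mul_apply, Fin.sum_univ_five]

theorem torus_mem_orbit (u : Aˣ) (v : Fin 5 → A) :
    ![u * v 0, v 1, v 2, v 3, ((u⁻¹ : Aˣ) : A) * v 4] ∈ MulAction.orbit (SO32 A) v := by
  convert mulVec_mem_orbit_SO32 (g := !![(u : A), 0, 0, 0, 0; 0, 1, 0, 0, 0; 0, 0, 1, 0, 0;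
    0, 0, 0, 1, 0; 0, 0, 0, 0, ((u⁻¹ : Aˣ) : A)]) ?_ ?_ v using 1
  · ext i; fin_cases i <;> simp [Matrix.mulVec, dotProduct, Fin.sum_univ_five]
  · simp [Matrix.det_succ_row_zero, Fin.sum_univ_succ, Fin.succAbove]
  · ext i j; fin_cases i <;> fin_cases j <;> simp [J, Matrix.mul_apply, Fin.sum_univ_five]

variable [Invertible (2 : A)]

theorem unipotent_mem_orbit (x y z : A) (v : Fin 5 → A) :
    ![v 0 - z * v 1 - y * v 2 - x * v 3 + -(x * z + ⅟2 * y ^ 2) * v 4, v 1 + x * v 4,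
      v 2 + y * v 4, v 3 + z * v 4, v 4] ∈ MulAction.orbit (SO32 A) v := by
  convert mulVec_mem_orbit_SO32 (g := !![1, -z, -y, -x, -(x * z + ⅟2 * y ^ 2); 0, 1, 0, 0, x;
    0, 0, 1, 0, y; 0, 0, 0, 1, z; 0, 0, 0, 0, 1]) ?_ ?_ v using 1
  · ext i; fin_cases i <;> simp [Matrix.mulVec, dotProduct, Fin.sum_univ_five]; ring
  · simp [Matrix.det_succ_row_zero, Fin.sum_univ_succ, Fin.succAbove]
  · ext i j; fin_cases i <;> fin_cases j <;> simp [J, Matrix.mul_apply, Fin.sum_univ_five]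
    linear_combination -y ^ 2 * mul_invOf_self (2 : A)

theorem exists_mem_orbit_isUnit_last [IsLocalRing A] {v : Fin 5 → A} (hv : ∃ i, IsUnit (v i)) :
    ∃ w ∈ MulAction.orbit (SO32 A) v, IsUnit (w 4) := by
  have of_first {u : Fin 5 → A} (hu : u ∈ MulAction.orbit (SO32 A) v) (h : IsUnit (u 0)) :
      ∃ w ∈ MulAction.orbit (SO32 A) v, IsUnit (w 4) :=
    ⟨_, mem_orbit_trans hu (swap_outer_mem_orbit u), by simpa using h⟩
  obtain ⟨i, hi⟩ := hv
  fin_cases i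
  · exact of_first (MulAction.mem_orbit_self v) hi
  · exact of_first (swap_inner_mem_orbit v) (by simpa using hi)
  · -- The two unipotent moves with `y = ∓1` change the first coordinate by `± v 2`.
    have hsum : (v 0 + v 2 - ⅟2 * v 4) + -(v 0 - v 2 - ⅟2 * v 4) = 2 * v 2 := by ring
    have hunit : IsUnit ((v 0 + v 2 - ⅟2 * v 4) + -(v 0 - v 2 - ⅟2 * v 4)) :=
      hsum ▸ (isUnit_of_invertible 2).mul hi
    rcases IsLocalRing.isUnit_or_isUnit_of_isUnit_add hunit with h | h
    · exact of_first (unipotent_mem_orbit 0 (-1) 0 v) (by simpa [sub_eq_add_neg] using h)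
    · exact of_first (unipotent_mem_orbit 0 1 0 v) (by simpa [sub_eq_add_neg] using h.neg)
  · exact ⟨_, swap_inner_mem_orbit v, by simpa using hi⟩
  · exact ⟨v, MulAction.mem_orbit_self v, hi⟩

theorem normalForm_mem_orbit [IsLocalRing A] {v : Fin 5 → A} (hv : ∃ i, IsUnit (v i)) :
    ![⅟2 * quadForm v, 0, 0, 0, 1] ∈ MulAction.orbit (SO32 A) v := by
  obtain ⟨w, hw, u, hu⟩ := exists_mem_orbit_isUnit_last hv
  set w' := ![u * w 0, w 1, w 2, w 3, ((u⁻¹ : Aˣ) : A) * w 4] with hw'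
  have hw'₄ : w' 4 = 1 := by simp [hw', ← hu]
  obtain ⟨t, ht⟩ : ∃ t, ![t, 0, 0, 0, 1] ∈ MulAction.orbit (SO32 A) v := by
    have h := mem_orbit_trans hw (mem_orbit_trans (torus_mem_orbit u w)
      (unipotent_mem_orbit (-w' 1) (-w' 2) (-w' 3) w'))
    simp only [hw'₄, mul_one, add_neg_cancel] at h
    exact ⟨_, h⟩
  have hq : quadForm v = 2 * t := by
    obtain ⟨g, hg⟩ := ht
    rw [← quadForm_smul_of_mem_SO32 g, show g • v = _ from hg, quadForm_eq]
    simp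
  rwa [hq, invOf_mul_cancel_left']

theorem mem_orbit_SO32_iff [IsLocalRing A] {v w : Fin 5 → A} (hv : ∃ i, IsUnit (v i)) :
    w ∈ MulAction.orbit (SO32 A) v ↔ quadForm w = quadForm v ∧ ∃ i, IsUnit (w i) := by
  constructor
  · rintro ⟨g, rfl⟩
    exact ⟨quadForm_smul_of_mem_SO32 g v, exists_isUnit_smul_apply g hv⟩
  · rintro ⟨hq, hw⟩
    have hvN := normalForm_mem_orbit hv
    rw [← hq, ← MulAction.orbit_eq_iff] at hvN
    rw [← MulAction.orbit_eq_iff, ← hvN]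
    exact (MulAction.orbit_eq_iff.2 (normalForm_mem_orbit hw)).symm

end Witt

section Coordinates

variable {F : Type*} [Field F]

theorem quadForm_aMat_mulVec_v₁ (θ : F) (α : Fˣ) : quadForm (aMat α *ᵥ v₁ θ) = 4 * θ := by
  simp only [quadForm_eq, aMat, v₁, Matrix.mulVec_diagonal, Matrix.cons_val]
  simp only [Units.val_inv_eq_inv_val, mul_one, mul_zero, add_zero, ne_eq,
    OfNat.ofNat_ne_zero, not_false_eq_true, zero_pow]
  have hα := α.ne_zero
  field_simp
  ring

theorem mulVec_v₀ (θ x₁ x₂ x₃ : F) (α : Fˣ) :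
    (nMat x₁ x₂ x₃ * aMat α * γ₀ F) *ᵥ v₀ θ = (α : F)⁻¹ •
      ![2 * θ * α ^ 2 - x₁ * (x₃ + α) - x₂ ^ 2 / 2, x₁, x₂, x₃ + α, 1] := by
  have hγ : γ₀ F *ᵥ v₀ θ = ![2 * θ, 0, 0, 1, 1] := by
    ext i
    fin_cases i <;> simp [γ₀, v₀, Matrix.mulVec, dotProduct, Fin.sum_univ_five]
  have ha : aMat α *ᵥ ![2 * θ, 0, 0, 1, 1] = ![2 * θ * α, 0, 0, 1, (α : F)⁻¹] := by
    ext i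
    fin_cases i <;> simp [aMat, Matrix.mulVec_diagonal, mul_comm]
  rw [← Matrix.mulVec_mulVec, hγ, ← Matrix.mulVec_mulVec, ha]
  have hα := α.ne_zero
  ext i
  fin_cases i <;> simp [nMat, Matrix.mulVec, dotProduct, Fin.sum_univ_five] <;> field_simp <;> ring

theorem quadForm_mulVec_v₀ (h2 : (2 : F) ≠ 0) (θ x₁ x₂ x₃ : F) (α : Fˣ) :
    quadForm ((nMat x₁ x₂ x₃ * aMat α * γ₀ F) *ᵥ v₀ θ) = 4 * θ := by
  have hα := α.ne_zero
  rw [mulVec_v₀, quadForm_smul, quadForm_eq]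
  simp only [Matrix.cons_val]
  field_simp
  ring

end Coordinates

section IntegralOrbit

variable {F : Type*} [Field F] [ValuativeRel F]

/-- The sup norm `max_j |w j|`, with values in the value group of `F`. -/
noncomputable def supNorm (w : Fin 5 → F) : ValueGroupWithZero F :=
  Finset.univ.sup fun j => valuation F (w j)

theorem supNorm_le_iff {w : Fin 5 → F} {c : ValueGroupWithZero F} :
    supNorm w ≤ c ↔ ∀ j, valuation F (w j) ≤ c := by
  simp [supNorm]

theorem valuation_apply_le_supNorm (w : Fin 5 → F) (j : Fin 5) : valuation F (w j) ≤ supNorm w :=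
  supNorm_le_iff.1 le_rfl j

theorem exists_valuation_apply_eq_supNorm (w : Fin 5 → F) : ∃ j, valuation F (w j) = supNorm w := by
  obtain ⟨j, -, hj⟩ := Finset.exists_mem_eq_sup Finset.univ ⟨0, Finset.mem_univ _⟩
    fun j => valuation F (w j)
  exact ⟨j, hj.symm⟩

theorem supNorm_smul (c : F) (w : Fin 5 → F) : supNorm (c • w) = valuation F c * supNorm w := by
  refine le_antisymm (supNorm_le_iff.2 fun j => ?_) ?_
  · rw [Pi.smul_apply, smul_eq_mul, map_mul]
    gcongr
    exact valuation_apply_le_supNorm w j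
  · obtain ⟨j, hj⟩ := exists_valuation_apply_eq_supNorm w
    rw [← hj, ← map_mul]
    exact valuation_apply_le_supNorm (c • w) j

theorem supNorm_coe {u : Fin 5 → 𝒪[F]} (hu : ∃ i, IsUnit (u i)) :
    supNorm (fun i => (u i : F)) = 1 := by
  obtain ⟨i, hi⟩ := hu
  refine le_antisymm (supNorm_le_iff.2 fun j => (u j).2) ?_
  rw [← isUnit_integer_iff.1 hi]
  exact valuation_apply_le_supNorm (fun i => (u i : F)) i

theorem exists_smul_coe_of_supNorm_eq {c : F} (hc : c ≠ 0) {w : Fin 5 → F}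
    (hw : supNorm w = valuation F c) :
    ∃ u : Fin 5 → 𝒪[F], (∃ i, IsUnit (u i)) ∧ w = c • fun i => (u i : F) := by
  have hv : valuation F c ≠ 0 := (valuation F).ne_zero_iff.2 hc
  obtain ⟨j, hj⟩ := exists_valuation_apply_eq_supNorm w
  refine ⟨fun i => ⟨c⁻¹ * w i, ?_⟩, ⟨j, isUnit_integer_iff.2 ?_⟩, ?_⟩
  · rw [Valuation.mem_integer_iff, map_mul, map_inv₀, inv_mul_le_iff₀ (zero_lt_iff.2 hv), mul_one,
      ← hw]
    exact valuation_apply_le_supNorm w i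
  · rw [map_mul, map_inv₀, hj, hw, inv_mul_cancel₀ hv]
  · ext i
    simp [hc]

theorem valuation_quadForm_le (w : Fin 5 → F) : valuation F (quadForm w) ≤ supNorm w ^ 2 := by
  have hmul (i j : Fin 5) : valuation F (w i * w j) ≤ supNorm w ^ 2 := by
    rw [map_mul, pow_two]
    gcongr <;> apply valuation_apply_le_supNorm
  have h2 (x : F) : valuation F (2 * x) ≤ valuation F x := by
    rw [map_mul]
    exact mul_le_of_le_one_left' (2 : 𝒪[F]).2
  rw [quadForm_eq, mul_assoc, mul_assoc, pow_two]
  exact (valuation F).map_add_le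
    ((valuation F).map_add_le ((h2 _).trans (hmul _ _)) ((h2 _).trans (hmul _ _))) (hmul _ _)

theorem mem_orbitK_smul_iff (c : F) (u : Fin 5 → 𝒪[F]) (w : Fin 5 → F) :
    w ∈ orbitK (c • fun i => (u i : F)) ↔
      ∃ u' ∈ MulAction.orbit (SO32 𝒪[F]) u, w = c • fun i => (u' i : F) := by
  have key (k : Matrix (Fin 5) (Fin 5) 𝒪[F]) : k.map (algebraMap 𝒪[F] F) *ᵥ
      (c • fun i => (u i : F)) = c • fun i => ((k *ᵥ u) i : F) := by
    rw [Matrix.mulVec_smul]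
    congr 1
  constructor
  · rintro ⟨k, hk, rfl⟩
    exact ⟨_, ⟨⟨k, hk⟩, rfl⟩, key _⟩
  · rintro ⟨_, ⟨⟨k, hk⟩, rfl⟩, rfl⟩
    exact ⟨k, hk, (key _).symm⟩

theorem mem_orbitK_iff (h2 : IsUnit (2 : 𝒪[F])) {v w : Fin 5 → F} (hv : v ≠ 0) :
    w ∈ orbitK v ↔ quadForm w = quadForm v ∧ supNorm w = supNorm v := by
  obtain ⟨j, hj⟩ := exists_valuation_apply_eq_supNorm v
  have hj₀ : v j ≠ 0 := fun h₀ => hv <| funext fun i => by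
    rw [h₀, map_zero] at hj
    simpa [← hj] using valuation_apply_le_supNorm v i
  obtain ⟨u, hu, huv⟩ := exists_smul_coe_of_supNorm_eq hj₀ hj.symm
  have : Invertible (2 : 𝒪[F]) := h2.invertible
  have hquad (u : Fin 5 → 𝒪[F]) : quadForm (fun i => (u i : F)) = (quadForm u : 𝒪[F]) :=
    quadForm_comp_ringHom (algebraMap 𝒪[F] F) u
  generalize v j = c at *
  subst huv
  rw [mem_orbitK_smul_iff]
  constructor
  · rintro ⟨u', hu', rfl⟩
    obtain ⟨hq, hunit⟩ := (mem_orbit_SO32_iff hu).1 hu'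
    simp only [quadForm_smul, hquad, hq, supNorm_smul, supNorm_coe, hu, hunit, and_self]
  · rintro ⟨hq, hn⟩
    obtain ⟨u', hu', rfl⟩ := exists_smul_coe_of_supNorm_eq hj₀ (hn.trans hj.symm)
    refine ⟨u', (mem_orbit_SO32_iff hu).2 ⟨Subtype.ext ?_, hu'⟩, rfl⟩
    simpa only [quadForm_smul, hquad, mul_right_inj' (pow_ne_zero 2 hj₀)] using hq

theorem supNorm_aMat_mulVec_v₁ {θ : F} (hθ : valuation F θ ≤ 1) {α : Fˣ}
    (hα : valuation F (α : F) ≤ 1) : supNorm (aMat α *ᵥ v₁ θ) = (valuation F (α : F))⁻¹ := by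
  have hinv : 1 ≤ (valuation F (α : F))⁻¹ := (one_le_inv₀ (valuation_pos α.ne_zero)).2 hα
  refine le_antisymm (supNorm_le_iff.2 fun j => ?_) ?_
  · fin_cases j
    · simpa [aMat, v₁, Matrix.mulVec_diagonal] using
        (mul_le_one' hα (mul_le_one' (2 : 𝒪[F]).2 hθ)).trans hinv
    all_goals simp [aMat, v₁, Matrix.mulVec_diagonal, hinv]
  · simpa [aMat, v₁, Matrix.mulVec_diagonal] using
      valuation_apply_le_supNorm (aMat α *ᵥ v₁ θ) 4

variable {ϖ : Fˣ} {θ : F}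

theorem φ_apply (h2 : IsUnit (2 : 𝒪[F])) (hϖ : valuation F (ϖ : F) ≤ 1) (hθ : valuation F θ ≤ 1)
    (n : ℕ) {w : Fin 5 → F} (hw : quadForm w = 4 * θ) :
    φ ϖ θ n w = {w | supNorm w = (valuation F (ϖ : F) ^ n)⁻¹}.indicator 1 w := by
  have hα : valuation F ((ϖ ^ n : Fˣ) : F) ≤ 1 := by simpa using pow_le_one₀ zero_le hϖ
  have hv : aMat (ϖ ^ n) *ᵥ v₁ θ ≠ 0 := fun h => by
    simpa [aMat, v₁, Matrix.mulVec_diagonal] using congrFun h 3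
  refine Set.indicator_eq_indicator ?_ rfl
  rw [mem_orbitK_iff h2 hv, quadForm_aMat_mulVec_v₁, supNorm_aMat_mulVec_v₁ hθ hα]
  simp [hw]

variable [IsDiscreteValuationRing 𝒪[F]]

theorem exists_supNorm_eq_inv_pow (h2 : IsUnit (2 : 𝒪[F])) (hϖ : IsUniformizer ϖ)
    (hθ : valuation F θ = 1) {w : Fin 5 → F} (hw : quadForm w = 4 * θ) :
    ∃ n : ℕ, supNorm w = (valuation F (ϖ : F) ^ n)⁻¹ := by
  have hv2 : valuation F (2 : F) = 1 := isUnit_integer_iff.1 h2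
  have hone : 1 ≤ supNorm w := by
    have h := valuation_quadForm_le w
    rw [hw, show (4 : F) = 2 * 2 by norm_num, map_mul, map_mul, hv2, hθ, one_mul, one_mul] at h
    exact (one_le_pow_iff_of_nonneg zero_le two_ne_zero).1 h
  obtain ⟨j, hj⟩ := exists_valuation_apply_eq_supNorm w
  rw [← hj] at hone ⊢
  obtain ⟨n, hn⟩ := hϖ.exists_valuation_eq_pow (x := (w j)⁻¹)
    (by rw [map_inv₀]; exact inv_le_one_of_one_le₀ hone)
    (inv_ne_zero fun h => by simp [h] at hone)
  exact ⟨n, by rw [← hn, map_inv₀, inv_inv]⟩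

theorem Φ_apply (h2 : IsUnit (2 : 𝒪[F])) (hϖ : IsUniformizer ϖ) (hθ : valuation F θ = 1) (r : ℕ)
    {w : Fin 5 → F} (hw : quadForm w = 4 * θ) :
    Φ ϖ θ r w = {w | supNorm w ≤ (valuation F (ϖ : F) ^ r)⁻¹}.indicator 1 w := by
  classical
  obtain ⟨n, hn⟩ := exists_supNorm_eq_inv_pow h2 hϖ hθ hw
  have hpos : 0 < valuation F (ϖ : F) := valuation_pos ϖ.ne_zero
  have hinj := pow_right_injective₀ hpos hϖ.valuation_lt_one.ne
  have hφ (i : ℕ) : φ ϖ θ i w = if n = i then 1 else 0 := by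
    simp only [φ_apply h2 hϖ.valuation_lt_one.le hθ.le i hw, Set.indicator_apply,
      Set.mem_ofPred_eq, hn, inv_inj, hinj.eq_iff, Pi.one_apply]
  simp only [Φ, Finset.sum_apply, hφ, Finset.sum_ite_eq, Finset.mem_range, Nat.lt_succ_iff,
    Set.indicator_apply, Set.mem_ofPred_eq, hn, Pi.one_apply,
    inv_le_inv₀ (pow_pos hpos n) (pow_pos hpos r),
    pow_le_pow_iff_right_of_lt_one₀ hpos hϖ.valuation_lt_one]

end IntegralOrbit

section Region

variable {F : Type*} [Field F] [ValuativeRel F]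

/-- The ball `{x | |x| ≤ |b|}`, i.e. the fractional ideal `b R`, as an additive subgroup of `F`. -/
noncomputable def ball (b : F) : AddSubgroup F := (valuation F).leAddSubgroup (valuation F b)

/-- The sphere `{x | |x| = |b|}`. -/
def sphere (b : F) : Set F := {x | valuation F x = valuation F b}

@[simp]
theorem mem_ball {b x : F} : x ∈ ball b ↔ valuation F x ≤ valuation F b := Iff.rfl

theorem coe_ball (b : F) : (ball b : Set F) = {x | valuation F x ≤ valuation F b} := rfl

@[simp]
theorem mem_sphere {b x : F} : x ∈ sphere b ↔ valuation F x = valuation F b := Iff.rfl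

/-- The domain of integration of `Ψ(α, Φ_r)` in the coordinates `(x₁, x₂, x₃ + α)`, where
`b = α ϖ ^ (-r)` and `c = 2 θ α ^ 2`: the points for which `α • n a_α γ₀ v₀` has norm at most
`|b|`. -/
def region (b c : F) : Set (F × F × F) :=
  {p | supNorm ![c - p.1 * p.2.2 - p.2.1 ^ 2 / 2, p.1, p.2.1, p.2.2, 1] ≤ valuation F b}

theorem mem_region_iff {b : F} (hb : 1 ≤ valuation F b) {c : F} {p : F × F × F} :
    p ∈ region b c ↔ p.1 ∈ ball b ∧ p.2.1 ∈ ball b ∧ p.2.2 ∈ ball b ∧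
      p.1 * p.2.2 + (p.2.1 ^ 2 / 2 - c) ∈ ball b := by
  have hneg : valuation F (c - p.1 * p.2.2 - p.2.1 ^ 2 / 2) =
      valuation F (p.1 * p.2.2 + (p.2.1 ^ 2 / 2 - c)) := by
    rw [← Valuation.map_neg]
    ring_nf
  simp only [region, supNorm_le_iff, Fin.forall_fin_succ, Fin.isValue, Matrix.cons_val_zero,
    Matrix.cons_val_succ, Matrix.cons_val_fin_one, map_one, hb, implies_true, and_true,
    Set.mem_ofPred_eq, hneg, mem_ball]
  tauto

theorem add_mem_sphere_iff {b t y : F} (ht : valuation F t < valuation F b) :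
    t + y ∈ sphere b ↔ y ∈ sphere b := by
  refine ⟨fun h => ?_, fun h => ?_⟩
  · rw [mem_sphere, ← neg_add_cancel_left t y, Valuation.map_add_eq_of_lt_right]
    · exact h
    · rwa [Valuation.map_neg, mem_sphere.1 h]
  · rw [mem_sphere, Valuation.map_add_eq_of_lt_right _ (by rwa [mem_sphere.1 h]), mem_sphere.1 h]

theorem region_eq_empty {b : F} (hb : valuation F b < 1) (c : F) : region b c = ∅ :=
  Set.eq_empty_of_forall_notMem fun p hp =>
    (supNorm_le_iff.1 hp 4).not_gt (by simpa using hb)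

theorem Φ_mulVec_v₀ [IsDiscreteValuationRing 𝒪[F]] (h2 : IsUnit (2 : 𝒪[F])) {ϖ : Fˣ}
    (hϖ : IsUniformizer ϖ) {θ : F} (hθ : valuation F θ = 1) (r : ℕ) (b : Fˣ) (x₁ x₂ x₃ : F) :
    Φ ϖ θ r ((nMat x₁ x₂ x₃ * aMat (b * ϖ ^ r) * γ₀ F) *ᵥ v₀ θ) =
      (region (b : F) (2 * θ * (b * ϖ ^ r) ^ 2)).indicator 1 (x₁, x₂, x₃ + b * ϖ ^ r) := by
  have h20 : (2 : F) ≠ 0 :=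
    ne_zero_of_valuation_eq one_ne_zero ((isUnit_integer_iff.1 h2).trans (map_one _).symm)
  have hpos : 0 < valuation F (ϖ : F) ^ r := pow_pos (valuation_pos ϖ.ne_zero) r
  rw [Φ_apply h2 hϖ hθ r (quadForm_mulVec_v₀ h20 θ _ _ _ _)]
  refine Set.indicator_eq_indicator ?_ rfl
  rw [mulVec_v₀, Set.mem_ofPred_eq, supNorm_smul, map_inv₀,
    inv_mul_le_iff₀ (valuation_pos (Units.ne_zero _)), region, Set.mem_ofPred_eq]
  simp [hpos.ne']

end Region

section Invariance

variable {G : Type*} [Group G] [MeasurableSpace G] [MeasurableMul G] (μ : Measure G)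
  [μ.IsMulLeftInvariant]

@[to_additive]
theorem setIntegral_eq_zero_of_mul_left {s : Set G} (hs : MeasurableSet s) {g : G}
    (hgs : ∀ x, g * x ∈ s ↔ x ∈ s) {f : G → ℂ} {c : ℂ} (hc : c ≠ 1)
    (hf : ∀ x ∈ s, f (g * x) = c * f x) : ∫ x in s, f x ∂μ = 0 := by
  have hpre : (g * ·) ⁻¹' s = s := Set.ext hgs
  have hinv : ∫ x in s, f (g * x) ∂μ = ∫ x in s, f x ∂μ := by
    simpa only [hpre] using (measurePreserving_mul_left μ g).setIntegral_preimage_emb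
      (measurableEmbedding_mulLeft g) f s
  rw [setIntegral_congr_fun hs hf, integral_const_mul] at hinv
  exact not_imp_comm.1 (fun h₀ => (mul_eq_right₀ h₀).1 hinv) hc

end Invariance

theorem relIndex_mul_measure {G : Type*} [AddGroup G] [MeasurableSpace G] [MeasurableAdd G]
    (μ : Measure G) [μ.IsAddLeftInvariant] {H K : AddSubgroup G} (hHK : H ≤ K)
    [H.IsFiniteRelIndex K] (hH : MeasurableSet (H : Set G)) (hK : MeasurableSet (K : Set G)) :
    H.relIndex K * μ H = μ K := by
  have : MeasurableAdd K :=
    { measurable_const_add := fun g =>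
        ((measurable_const_add (g : G)).comp measurable_subtype_coe).subtype_mk
      measurable_add_const := fun g =>
        ((measurable_add_const (g : G)).comp measurable_subtype_coe).subtype_mk }
  have hemb : MeasurableEmbedding K.subtype := .subtype_coe hK
  have := Measure.IsAddLeftInvariant.comap μ hemb
  have h := (H.addSubgroupOf K).index_mul_measure (measurable_subtype_coe hH) (μ.comap K.subtype)
  rw [hemb.comap_apply, hemb.comap_apply, Set.image_univ] at h
  rwa [← AddSubgroup.coe_map, AddSubgroup.map_addSubgroupOf_eq_of_le hHK, AddSubgroup.coe_subtype,
    Subtype.range_coe] at h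

section Topology

variable {F : Type*} [Field F] [ValuativeRel F] [TopologicalSpace F] [IsNonarchimedeanLocalField F]

theorem isClopen_ball {b : F} (hb : b ≠ 0) : IsClopen (ball b : Set F) := by
  have h := Valuation.isClopen_closedBall (v := valuation F) (r := (valuation F).restrict b)
    (by simpa using hb)
  rw [coe_ball]
  simpa only [(valuation F).restrict_le_iff] using h

theorem isClopen_sphere {b : F} (hb : b ≠ 0) : IsClopen (sphere b) := by
  convert Valuation.isClopen_sphere (v := valuation F) (r := (valuation F).restrict b)
    (by simpa using hb) using 2
  ext x
  simp [le_antisymm_iff, (valuation F).restrict_le_iff]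

theorem isCompact_ball (b : F) : IsCompact (ball b : Set F) :=
  coe_ball b ▸ IsNonarchimedeanLocalField.isCompact_closedBall F _

theorem isCompact_sphere {b : F} (hb : b ≠ 0) : IsCompact (sphere b) :=
  (isCompact_ball b).of_isClosed_subset (isClopen_sphere hb).1 fun _ hx => le_of_eq hx

theorem isCompact_region {b : F} (hb : b ≠ 0) (c : F) : IsCompact (region b c) := by
  rcases lt_or_ge (valuation F b) 1 with hb₁ | hb₁
  · rw [region_eq_empty hb₁]
    exact isCompact_empty
  have hball := (isCompact_ball b).prod ((isCompact_ball b).prod (isCompact_ball b))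
  refine hball.of_isClosed_subset ?_ fun p hp => ?_
  · have hset : region b c = {p | p.1 ∈ ball b} ∩ ({p | p.2.1 ∈ ball b} ∩ ({p | p.2.2 ∈ ball b} ∩
        {p | p.1 * p.2.2 + (p.2.1 ^ 2 / 2 - c) ∈ ball b})) :=
      Set.ext fun p => mem_region_iff hb₁
    rw [hset]
    have hcl := (isClopen_ball hb).1
    exact (hcl.preimage (by fun_prop)).inter ((hcl.preimage (by fun_prop)).inter
      ((hcl.preimage (by fun_prop)).inter (hcl.preimage (by fun_prop))))
  · obtain ⟨h₁, h₂, h₃, -⟩ := (mem_region_iff hb₁).1 hp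
    exact ⟨h₁, h₂, h₃⟩

end Topology

namespace HasConductorIntegers

variable {F : Type*} [Field F] [ValuativeRel F] {ψ : AddChar F ℂ} {ϖ : Fˣ}

theorem map_eq_one (hψ : HasConductorIntegers ψ ϖ) {x : F} (hx : valuation F x ≤ 1) : ψ x = 1 :=
  hψ.1 x hx

theorem exists_map_ne_one (hψ : HasConductorIntegers ψ ϖ) :
    ∃ t, valuation F t ≤ valuation F (ϖ : F)⁻¹ ∧ ψ t ≠ 1 := by
  obtain ⟨x, hx, hψx⟩ := hψ.2
  refine ⟨_, ?_, hψx⟩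
  rw [map_mul, Units.val_inv_eq_inv_val]
  exact mul_le_of_le_one_right' hx

theorem map_eq_map (hψ : HasConductorIntegers ψ ϖ) {x y : F} (hxy : valuation F (x - y) ≤ 1) :
    ψ x = ψ y := by
  rw [← sub_add_cancel x y, AddChar.map_add_eq_mul, hψ.map_eq_one hxy, one_mul]

theorem continuous [TopologicalSpace F] [IsNonarchimedeanLocalField F]
    (hψ : HasConductorIntegers ψ ϖ) : Continuous ψ := by
  refine continuous_iff_continuousAt.2 fun x => (continuousAt_const (y := ψ x)).congr ?_
  have hopen : IsOpen {y : F | y - x ∈ ball (1 : F)} :=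
    (isClopen_ball one_ne_zero).2.preimage (continuous_id.sub continuous_const)
  filter_upwards [hopen.mem_nhds (by simp)] with y hy
  exact (hψ.map_eq_map (by simpa using hy)).symm

end HasConductorIntegers

section HaarMeasure

variable {F : Type*} [Field F] [ValuativeRel F]

theorem coe_ball_one : (ball (1 : F) : Set F) = 𝒪[F] := by
  ext x
  simp [Valuation.mem_integer_iff]

theorem IsUniformizer.relIndex_ball {ϖ : Fˣ} (hϖ : IsUniformizer ϖ) :
    (ball (1 : F)).relIndex (ball (ϖ : F)⁻¹) = Nat.card 𝓀[F] := by
  have hpos := valuation_pos ϖ.ne_zero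
  have hmax : (ball (1 : F)).relIndex (ball (ϖ : F)⁻¹) = (ball (ϖ : F)).relIndex (ball 1) := by
    have hmap (b : F) : (ball b).map (AddMonoidHom.mulLeft (ϖ : F)) = ball (ϖ * b) := by
      ext x
      refine ⟨?_, fun hx => ⟨(ϖ : F)⁻¹ * x, ?_, by simp⟩⟩
      · rintro ⟨y, hy, rfl⟩
        simpa using mul_le_mul_right hy (valuation F (ϖ : F))
      · simpa [inv_mul_le_iff₀ hpos] using hx
    rw [← AddSubgroup.relIndex_map_map_of_injective (f := AddMonoidHom.mulLeft (ϖ : F)) _ _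
      (mul_right_injective₀ ϖ.ne_zero), hmap, hmap, mul_one, mul_inv_cancel₀ ϖ.ne_zero]
  have hker : (ball (ϖ : F)).comap 𝒪[F].subtype.toAddMonoidHom = 𝓂[F].toAddSubgroup := by
    ext x
    exact ⟨fun hx => mem_maximalIdeal_integer_iff.2 (hx.trans_lt hϖ.valuation_lt_one),
      fun hx => hϖ.valuation_le_of_lt_one (mem_maximalIdeal_integer_iff.1 hx)⟩
  have hrange : 𝒪[F].subtype.toAddMonoidHom.range = ball (1 : F) := by
    ext x
    simp [Valuation.mem_integer_iff]
  rw [hmax, ← hrange, ← AddSubgroup.index_comap, hker]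
  rfl

variable [TopologicalSpace F] [IsNonarchimedeanLocalField F] [MeasurableSpace F] [BorelSpace F]
  (μ : Measure F)

attribute [local instance] t2Space secondCountableTopology

theorem IsUniformizer.measureReal_ball_inv [μ.IsAddHaarMeasure] (hμ : μ (ball (1 : F)) = 1)
    {ϖ : Fˣ} (hϖ : IsUniformizer ϖ) : μ.real (ball (ϖ : F)⁻¹) = Nat.card 𝓀[F] := by
  have : (ball (1 : F)).IsFiniteRelIndex (ball (ϖ : F)⁻¹) :=
    ⟨by rw [hϖ.relIndex_ball]; exact Nat.card_pos.ne'⟩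
  have hle : ball (1 : F) ≤ ball (ϖ : F)⁻¹ := fun x hx =>
    mem_ball.2 ((mem_ball.1 hx).trans ((map_one _).trans_le hϖ.one_lt_valuation_inv.le))
  have h := relIndex_mul_measure μ hle (isClopen_ball one_ne_zero).1.measurableSet
    (isClopen_ball (inv_ne_zero ϖ.ne_zero)).1.measurableSet
  rw [measureReal_def, ← h, hμ, mul_one, hϖ.relIndex_ball, ENNReal.toReal_natCast]

theorem setIntegral_ball_eq_integral_ball_one [μ.IsAddHaarMeasure] (hμ : μ (ball (1 : F)) = 1)
    {b y : F} (hb : b ≠ 0) (hy : valuation F y = valuation F b) (g : F → ℂ) :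
    ∫ x in ball b, g x ∂μ = μ.real (ball b) * ∫ z in ball (1 : F), g (y * z) ∂μ := by
  have hy₀ := ne_zero_of_valuation_eq hb hy
  let e : F ≃ₜ+ F := ContinuousAddEquiv.mulLeft (Units.mk0 y hy₀)
  have hpre : e ⁻¹' (ball b : Set F) = ball (1 : F) := by
    ext z
    simp [e, hy, mul_le_iff_le_one_right (valuation_pos hb)]
  have hreal : (μ.real (ball b : Set F) : ℂ) = addEquivAddHaarChar e := by
    rw [measureReal_def, ← addEquivAddHaarChar_smul_preimage μ e, hpre, hμ]
    simp
  have hemb : MeasurableEmbedding e := e.toHomeomorph.measurableEmbedding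
  conv_lhs => rw [← addEquivAddHaarChar_smul_map μ e]
  rw [hreal, ← hpre, Measure.restrict_smul, integral_smul_nnreal_measure,
    hemb.setIntegral_map]
  rfl

end HaarMeasure

section Integral

variable {F : Type*} [Field F] [ValuativeRel F] [TopologicalSpace F] [IsNonarchimedeanLocalField F]
  [MeasurableSpace F] [BorelSpace F] (μ : Measure F) {ψ : AddChar F ℂ} {ϖ : Fˣ}

attribute [local instance] t2Space secondCountableTopology

/-- The set of `x` with `(x, z, y) ∈ region b c`, where `D = z ^ 2 / 2 - c`. -/
def slice (b y D : F) : Set F := {x | x ∈ ball b ∧ x * y + D ∈ ball b}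

theorem measurableSet_slice {b : F} (hb : b ≠ 0) (y D : F) : MeasurableSet (slice b y D) := by
  have hball := (isClopen_ball hb).1
  exact (hball.inter (hball.preimage (f := (· * y + D)) (by fun_prop))).measurableSet

theorem setIntegral_slice_eq_zero [μ.IsAddLeftInvariant] (hϖ : IsUniformizer ϖ)
    (hψ : HasConductorIntegers ψ ϖ) {b y : F} (hb : 1 < valuation F b)
    (hy : valuation F y < valuation F b) (D : F) : ∫ x in slice b y D, ψ x ∂μ = 0 := by
  have hb₀ : b ≠ 0 := (valuation F).ne_zero_iff.1 (zero_lt_one.trans hb).ne'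
  obtain ⟨t, ht, hψt⟩ := hψ.exists_map_ne_one
  have htb : t ∈ ball b := ht.trans (hϖ.valuation_inv_le_of_one_lt hb)
  have hty : t * y ∈ ball b := by
    rw [mem_ball, map_mul]
    calc valuation F t * valuation F y
        ≤ valuation F (ϖ : F)⁻¹ * (valuation F (ϖ : F) * valuation F b) :=
          mul_le_mul' ht (hϖ.valuation_le_mul_of_lt hy)
      _ = valuation F b := by rw [← map_mul, ← map_mul, inv_mul_cancel_left₀ ϖ.ne_zero]
  refine setIntegral_eq_zero_of_add_left μ (measurableSet_slice hb₀ y D) (g := t) (fun x => ?_)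
    hψt fun x _ => AddChar.map_add_eq_mul ψ t x
  simp only [slice, Set.mem_ofPred_eq, add_mul, add_assoc, AddSubgroup.add_mem_cancel_left _ htb,
    AddSubgroup.add_mem_cancel_left _ hty]

theorem setIntegral_slice_eq [μ.IsAddLeftInvariant] (hψ : HasConductorIntegers ψ ϖ)
    (hμ : μ (ball (1 : F)) = 1) {b y D : F} (hb : 1 ≤ valuation F b)
    (hy : valuation F y = valuation F b) (hD : valuation F D ≤ valuation F b ^ 2) :
    ∫ x in slice b y D, ψ x ∂μ = ψ (-(D / y)) := by
  have hb₀ : b ≠ 0 := (valuation F).ne_zero_iff.1 (zero_lt_one.trans_le hb).ne'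
  have hy₀ : y ≠ 0 := ne_zero_of_valuation_eq hb₀ hy
  have hDy : D / y ∈ ball b := by
    rw [mem_ball, map_div₀, hy, div_le_iff₀ (valuation_pos hb₀), ← pow_two]
    exact hD
  have hcoset : (-(D / y) + ·) ⁻¹' slice b y D = (ball (1 : F) : Set F) := by
    ext x
    have hmul : (-(D / y) + x) * y + D = x * y := by field_simp; ring
    simp only [slice, Set.mem_preimage, Set.mem_ofPred_eq, hmul, SetLike.mem_coe, mem_ball,
      map_mul, hy, map_one, mul_le_iff_le_one_left (valuation_pos hb₀)]
    exact and_iff_right_of_imp fun hx => mem_ball.1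
      (add_mem (neg_mem hDy) (mem_ball.2 (hx.trans hb)))
  rw [← (measurePreserving_add_left μ (-(D / y))).setIntegral_preimage_emb
      (measurableEmbedding_addLeft _), hcoset]
  calc ∫ x in ball (1 : F), ψ (-(D / y) + x) ∂μ = ∫ _ in ball (1 : F), ψ (-(D / y)) ∂μ :=
        setIntegral_congr_fun (isClopen_ball one_ne_zero).1.measurableSet fun x hx =>
          hψ.map_eq_map (by simpa using hx)
    _ = ψ (-(D / y)) := by simp [measureReal_def, hμ]

theorem setIntegral_ball_mul_eq_zero [μ.IsAddLeftInvariant] (hψ : HasConductorIntegers ψ ϖ)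
    {b w : F} (hb : valuation F (ϖ : F)⁻¹ ≤ valuation F b) (hw : valuation F w = 1) :
    ∫ y in ball b, ψ (w * y) ∂μ = 0 := by
  have hb₀ : b ≠ 0 := (valuation F).ne_zero_iff.1
    ((valuation_pos (inv_ne_zero ϖ.ne_zero)).trans_le hb).ne'
  have hw₀ : w ≠ 0 := ne_zero_of_valuation_eq one_ne_zero (by rw [hw, map_one])
  obtain ⟨t, ht, hψt⟩ := hψ.exists_map_ne_one
  have htw : t / w ∈ ball b := by simpa [hw] using ht.trans hb
  refine setIntegral_eq_zero_of_add_left μ (isClopen_ball hb₀).1.measurableSet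
    (fun x => AddSubgroup.add_mem_cancel_left _ htw) hψt fun x _ => ?_
  rw [mul_add, mul_div_cancel₀ _ hw₀, AddChar.map_add_eq_mul]

theorem setIntegral_sphere_eq_zero [μ.IsAddLeftInvariant] (hψ : HasConductorIntegers ψ ϖ)
    {b w c : F} (hb : valuation F (ϖ : F)⁻¹ < valuation F b) (hw : valuation F w = 1)
    (hc : valuation F c ≤ valuation F (ϖ : F) * valuation F b ^ 2) :
    ∫ y in sphere b, ψ (w * y + c / y) ∂μ = 0 := by
  have hb₀ : b ≠ 0 := (valuation F).ne_zero_iff.1 (zero_le.trans_lt hb).ne'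
  have hw₀ : w ≠ 0 := ne_zero_of_valuation_eq one_ne_zero (by rw [hw, map_one])
  obtain ⟨s, hs, hψs⟩ := hψ.exists_map_ne_one
  have ht : valuation F (s / w) ≤ valuation F (ϖ : F)⁻¹ := by rwa [map_div₀, hw, div_one]
  have hts (y : F) := add_mem_sphere_iff (y := y) (ht.trans_lt hb)
  refine setIntegral_eq_zero_of_add_left μ (isClopen_sphere hb₀).1.measurableSet hts hψs
    fun y hy => ?_
  have hy₀ : y ≠ 0 := ne_zero_of_valuation_eq hb₀ hy
  have hty₀ : s / w + y ≠ 0 := ne_zero_of_valuation_eq hb₀ ((hts y).2 hy)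
  have hdiff : w * (s / w + y) + c / (s / w + y) - (s + (w * y + c / y)) =
      -(c * (s / w) / (y * (s / w + y))) := by
    rw [mul_add, mul_div_cancel₀ _ hw₀]
    generalize s / w = t at hty₀ ⊢
    field_simp
    ring
  rw [← AddChar.map_add_eq_mul]
  refine hψ.map_eq_map ?_
  rw [hdiff, Valuation.map_neg, map_div₀, map_mul, map_mul, mem_sphere.1 hy,
    mem_sphere.1 ((hts y).2 hy), ← pow_two, div_le_one₀ (pow_pos (valuation_pos hb₀) 2)]
  calc valuation F c * valuation F (s / w)
      ≤ valuation F (ϖ : F) * valuation F b ^ 2 * valuation F (ϖ : F)⁻¹ := mul_le_mul' hc ht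
    _ = valuation F b ^ 2 := by
      rw [mul_right_comm, ← map_mul, mul_inv_cancel₀ ϖ.ne_zero, map_one, one_mul]

theorem setIntegral_sphere_eq_neg_one [μ.IsAddHaarMeasure] (hϖ : IsUniformizer ϖ)
    (hψ : HasConductorIntegers ψ ϖ) (hμ : μ (ball (1 : F)) = 1) {b w c : F}
    (hb : valuation F b = valuation F (ϖ : F)⁻¹) (hw : valuation F w = 1)
    (hc : valuation F c ≤ valuation F b) :
    ∫ y in sphere b, ψ (w * y + c / y) ∂μ = -1 := by
  have hb₀ : b ≠ 0 := ne_zero_of_valuation_eq (inv_ne_zero ϖ.ne_zero) hb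
  have hb₁ : 1 < valuation F b := hb ▸ hϖ.one_lt_valuation_inv
  have hlt (y : F) : valuation F y < valuation F b ↔ valuation F y ≤ 1 := by
    refine ⟨fun h => ?_, fun h => h.trans_lt hb₁⟩
    simpa [hb, ϖ.ne_zero] using hϖ.valuation_le_mul_of_lt h
  have hsphere : sphere b = (ball b : Set F) \ ball (1 : F) := by
    ext y
    simp [← hlt, le_antisymm_iff]
  have hle : (ball (1 : F) : Set F) ⊆ ball b := fun _ hy =>
    ((hlt _).2 (by simpa using hy)).le
  have hmeas₁ : MeasurableSet (ball (1 : F) : Set F) := (isClopen_ball one_ne_zero).1.measurableSet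
  have hint : IntegrableOn (fun y => ψ (w * y)) (ball b : Set F) μ :=
    (hψ.continuous.comp (continuous_const_mul w)).continuousOn.integrableOn_compact
      (isCompact_ball b)
  calc ∫ y in sphere b, ψ (w * y + c / y) ∂μ = ∫ y in sphere b, ψ (w * y) ∂μ :=
        setIntegral_congr_fun (isClopen_sphere hb₀).1.measurableSet fun y hy => hψ.map_eq_map <| by
          rw [add_sub_cancel_left, map_div₀, mem_sphere.1 hy]
          exact (div_le_one₀ (valuation_pos hb₀)).2 hc
    _ = ∫ y in ball b, ψ (w * y) ∂μ - ∫ y in ball (1 : F), ψ (w * y) ∂μ := by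
        rw [hsphere, setIntegral_sdiff hmeas₁ hint hle]
    _ = 0 - ∫ _ in ball (1 : F), (1 : ℂ) ∂μ := by
        rw [setIntegral_ball_mul_eq_zero μ hψ hb.ge hw, setIntegral_congr_fun hmeas₁ fun _ hy =>
          hψ.map_eq_one (by simpa [hw] using hy)]
    _ = -1 := by simp [measureReal_def, hμ]

end Integral

section RegionIntegral

variable {F : Type*} [Field F] [ValuativeRel F] [TopologicalSpace F] [IsNonarchimedeanLocalField F]
  [MeasurableSpace F] [BorelSpace F] (μ : Measure F) [μ.IsAddHaarMeasure] {ψ : AddChar F ℂ}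
  {ϖ : Fˣ}

attribute [local instance] t2Space secondCountableTopology

theorem integrableOn_region (hψ : HasConductorIntegers ψ ϖ) {b : F} (hb : b ≠ 0) (a c : F) :
    IntegrableOn (fun p => ψ (p.1 + a * p.2.2)) (region b c) (μ.prod (μ.prod μ)) :=
  (hψ.continuous.comp (by fun_prop)).continuousOn.integrableOn_compact (isCompact_region hb c)

theorem integrableOn_ball_prod_sphere (hψ : HasConductorIntegers ψ ϖ) {b : F} (hb : b ≠ 0)
    (d : F) {f g : F × F → F} (hf : Continuous f) (hg : Continuous g) :
    IntegrableOn (fun q => ψ (f q + g q / q.2)) (ball d ×ˢ sphere b) (μ.prod μ) := by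
  refine ContinuousOn.integrableOn_compact ((isCompact_ball d).prod (isCompact_sphere hb))
    (hψ.continuous.comp_continuousOn (hf.continuousOn.add (hg.continuousOn.div (by fun_prop) ?_)))
  exact fun q hq => ne_zero_of_valuation_eq hb hq.2

theorem setIntegral_preimage_region (hϖ : IsUniformizer ϖ) (hψ : HasConductorIntegers ψ ϖ)
    (hμ : μ (ball (1 : F)) = 1) (h2 : valuation F (2 : F) = 1) {b c : F} (hb : 1 < valuation F b)
    (hc : valuation F c ≤ valuation F b ^ 2) (a : F) (q : F × F) :
    ∫ x in (·, q) ⁻¹' region b c, ψ (x + a * q.2) ∂μ =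
      (ball b ×ˢ sphere b : Set (F × F)).indicator
        (fun q => ψ (a * q.2 + (c - q.1 ^ 2 / 2) / q.2)) q := by
  obtain ⟨z, y⟩ := q
  by_cases hzy : z ∈ ball b ∧ y ∈ ball b
  swap
  · have hempty : (·, (z, y)) ⁻¹' region b c = (∅ : Set F) :=
      Set.eq_empty_of_forall_notMem fun x hx =>
        hzy ⟨((mem_region_iff hb.le).1 hx).2.1, ((mem_region_iff hb.le).1 hx).2.2.1⟩
    rw [hempty, setIntegral_empty, Set.indicator_of_notMem]
    exact fun h => hzy ⟨h.1, h.2.le⟩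
  obtain ⟨hz, hy⟩ := hzy
  have hslice : (·, (z, y)) ⁻¹' region b c = slice b y (z ^ 2 / 2 - c) := by
    ext x
    simp only [Set.mem_preimage, mem_region_iff hb.le, slice, Set.mem_ofPred_eq]
    tauto
  simp only [hslice, AddChar.map_add_eq_mul, integral_mul_const]
  rcases (mem_ball.1 hy).lt_or_eq with hlt | heq
  · rw [setIntegral_slice_eq_zero μ hϖ hψ hb hlt, zero_mul,
      Set.indicator_of_notMem fun h => hlt.ne h.2]
  · have hD : valuation F (z ^ 2 / 2 - c) ≤ valuation F b ^ 2 :=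
      (valuation F).map_sub_le (by simpa [h2] using pow_le_pow_left' hz 2) hc
    rw [setIntegral_slice_eq μ hψ hμ hb.le heq hD,
      Set.indicator_of_mem (show (z, y) ∈ _ ×ˢ sphere b from ⟨hz, heq⟩), mul_comm, ← neg_div,
      neg_sub]

theorem setIntegral_region_eq_setIntegral_ball_prod_sphere (hϖ : IsUniformizer ϖ)
    (hψ : HasConductorIntegers ψ ϖ) (hμ : μ (ball (1 : F)) = 1) (h2 : valuation F (2 : F) = 1)
    {b c : F} (hb : 1 < valuation F b) (hc : valuation F c ≤ valuation F b ^ 2) (a : F) :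
    ∫ p in region b c, ψ (p.1 + a * p.2.2) ∂(μ.prod (μ.prod μ)) =
      ∫ q in ball b ×ˢ sphere b, ψ (a * q.2 + (c - q.1 ^ 2 / 2) / q.2) ∂(μ.prod μ) := by
  have hb₀ : b ≠ 0 := (valuation F).ne_zero_iff.1 (zero_lt_one.trans hb).ne'
  have hregion : MeasurableSet (region b c) := (isCompact_region hb₀ c).measurableSet
  have hprod : MeasurableSet (ball b ×ˢ sphere b : Set (F × F)) :=
    ((isCompact_ball b).prod (isCompact_sphere hb₀)).measurableSet
  rw [← integral_indicator hregion, integral_prod_symm _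
    ((integrable_indicator_iff hregion).2 (integrableOn_region μ hψ hb₀ a c)),
    ← integral_indicator hprod]
  congr 1 with q
  rw [← setIntegral_preimage_region μ hϖ hψ hμ h2 hb hc,
    ← integral_indicator (hregion.preimage measurable_prodMk_right)]
  rfl

theorem setIntegral_ball_prod_sphere (hψ : HasConductorIntegers ψ ϖ)
    (hμ : μ (ball (1 : F)) = 1) {a b c : F} (hb : b ≠ 0) {κ : ℂ}
    (hκ : ∀ z ∈ ball (1 : F), ∫ y in sphere b, ψ ((a - z ^ 2 / 2) * y + c / y) ∂μ = κ) :
    ∫ q in ball b ×ˢ sphere b, ψ (a * q.2 + (c - q.1 ^ 2 / 2) / q.2) ∂(μ.prod μ) =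
      μ.real (ball b) * κ := by
  have hsphere : MeasurableSet (sphere b) := (isClopen_sphere hb).1.measurableSet
  have hint := integrableOn_ball_prod_sphere μ hψ hb b (f := fun q => a * q.2)
    (g := fun q => c - q.1 ^ 2 / 2) (by fun_prop) (by fun_prop)
  have hint' := integrableOn_ball_prod_sphere μ hψ hb 1 (f := fun q => (a - q.1 ^ 2 / 2) * q.2)
    (g := fun _ => c) (by fun_prop) (by fun_prop)
  rw [IntegrableOn, ← Measure.prod_restrict] at hint hint'
  calc ∫ q in ball b ×ˢ sphere b, ψ (a * q.2 + (c - q.1 ^ 2 / 2) / q.2) ∂(μ.prod μ)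
      = ∫ y in sphere b, ∫ x in ball b, ψ (a * y + (c - x ^ 2 / 2) / y) ∂μ ∂μ := by
        rw [← Measure.prod_restrict, integral_prod_symm _ hint]
    _ = ∫ y in sphere b, μ.real (ball b) *
          ∫ z in ball (1 : F), ψ ((a - z ^ 2 / 2) * y + c / y) ∂μ ∂μ :=
        setIntegral_congr_fun hsphere fun y hy => by
          have : y ≠ 0 := ne_zero_of_valuation_eq hb hy
          simp only [setIntegral_ball_eq_integral_ball_one μ hμ hb hy]
          congr 3 with z
          refine congrArg ψ ?_
          field_simp
          ring
    _ = μ.real (ball b) *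
          ∫ z in ball (1 : F), ∫ y in sphere b, ψ ((a - z ^ 2 / 2) * y + c / y) ∂μ ∂μ := by
        rw [integral_const_mul, ← integral_integral_swap hint']
    _ = μ.real (ball b) * κ := by
        rw [setIntegral_congr_fun (isClopen_ball one_ne_zero).1.measurableSet hκ]
        simp [measureReal_def, hμ]

theorem setIntegral_region_eq_zero (hϖ : IsUniformizer ϖ) (hψ : HasConductorIntegers ψ ϖ)
    (hμ : μ (ball (1 : F)) = 1) (h2 : valuation F (2 : F) = 1) {a b c : F}
    (ha : ∀ z ∈ ball (1 : F), valuation F (a - z ^ 2 / 2) = 1)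
    (hb : valuation F (ϖ : F)⁻¹ < valuation F b)
    (hc : valuation F c ≤ valuation F (ϖ : F) * valuation F b ^ 2) :
    ∫ p in region b c, ψ (p.1 + a * p.2.2) ∂(μ.prod (μ.prod μ)) = 0 := by
  have hb₁ := hϖ.one_lt_valuation_inv.trans hb
  rw [setIntegral_region_eq_setIntegral_ball_prod_sphere μ hϖ hψ hμ h2 hb₁
      (hc.trans (mul_le_of_le_one_left' hϖ.valuation_lt_one.le)),
    setIntegral_ball_prod_sphere μ hψ hμ ((valuation F).ne_zero_iff.1 (zero_le.trans_lt hb).ne')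
      fun z hz => setIntegral_sphere_eq_zero μ hψ hb (ha z hz) hc, mul_zero]

theorem setIntegral_region_eq_neg_card (hϖ : IsUniformizer ϖ) (hψ : HasConductorIntegers ψ ϖ)
    (hμ : μ (ball (1 : F)) = 1) (h2 : valuation F (2 : F) = 1) {a b c : F}
    (ha : ∀ z ∈ ball (1 : F), valuation F (a - z ^ 2 / 2) = 1)
    (hb : valuation F b = valuation F (ϖ : F)⁻¹) (hc : valuation F c ≤ valuation F b) :
    ∫ p in region b c, ψ (p.1 + a * p.2.2) ∂(μ.prod (μ.prod μ)) = -Nat.card 𝓀[F] := by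
  have hb₁ : 1 < valuation F b := hb ▸ hϖ.one_lt_valuation_inv
  have hball : ball b = ball (ϖ : F)⁻¹ := by rw [ball, ball, hb]
  rw [setIntegral_region_eq_setIntegral_ball_prod_sphere μ hϖ hψ hμ h2 hb₁
      (hc.trans (le_self_pow₀ hb₁.le two_ne_zero)),
    setIntegral_ball_prod_sphere μ hψ hμ (ne_zero_of_valuation_eq (inv_ne_zero ϖ.ne_zero) hb)
      fun z hz => setIntegral_sphere_eq_neg_one μ hϖ hψ hμ hb (ha z hz) hc, hball,
    hϖ.measureReal_ball_inv μ hμ, mul_neg_one, Complex.ofReal_natCast]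

theorem setIntegral_region_eq_one (hψ : HasConductorIntegers ψ ϖ)
    (hμ : μ (ball (1 : F)) = 1) (h2 : valuation F (2 : F) = 1) {a b c : F}
    (ha : valuation F a ≤ 1) (hb : valuation F b = 1) (hc : valuation F c ≤ 1) :
    ∫ p in region b c, ψ (p.1 + a * p.2.2) ∂(μ.prod (μ.prod μ)) = 1 := by
  have hregion : region b c = (ball (1 : F) : Set F) ×ˢ (ball (1 : F) : Set F) ×ˢ ball (1 : F) := by
    ext ⟨x, z, y⟩
    simp only [mem_region_iff hb.ge, mem_ball, hb, Set.mem_prod, SetLike.mem_coe, map_one]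
    refine ⟨fun h => ⟨h.1, h.2.1, h.2.2.1⟩, fun h => ⟨h.1, h.2.1, h.2.2, ?_⟩⟩
    exact (valuation F).map_add_le (by simpa using mul_le_one' h.1 h.2.2)
      ((valuation F).map_sub_le (by simpa [h2] using pow_le_one₀ zero_le h.2.1) hc)
  have hball : MeasurableSet (ball (1 : F) : Set F) := (isClopen_ball one_ne_zero).1.measurableSet
  rw [hregion]
  calc _ = ∫ _ in (ball (1 : F) : Set F) ×ˢ (ball (1 : F) : Set F) ×ˢ (ball (1 : F) : Set F),
        (1 : ℂ) ∂(μ.prod (μ.prod μ)) :=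
        setIntegral_congr_fun (hball.prod (hball.prod hball)) fun p hp => hψ.map_eq_one <|
          (valuation F).map_add_le (by simpa using hp.1)
            (by simpa using mul_le_one' ha (by simpa using hp.2.2))
    _ = 1 := by simp [measureReal_def, hμ]

end RegionIntegral

section Shell

variable {F : Type*} [Field F] [ValuativeRel F]

/-- The coset `g R^×` of elements of `F^×` with the same valuation as `g`. -/
def shell (g : Fˣ) : Set Fˣ := {α | valuation F (α : F) = valuation F (g : F)}

theorem measure_shell [MeasurableSpace Fˣ] [MeasurableMul Fˣ] (ν : Measure Fˣ)
    [ν.IsMulLeftInvariant] (g : Fˣ) : ν (shell g) = ν (integerUnits F) := by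
  rw [← measure_preimage_mul ν g]
  congr 1
  ext α
  simp [shell, integerUnits]

end Shell

section OrbitalIntegral

variable {F : Type*} [Field F] [ValuativeRel F] [TopologicalSpace F] [IsNonarchimedeanLocalField F]
  {ψ : AddChar F ℂ} {ϖ : Fˣ} {θ : F}

attribute [local instance] t2Space secondCountableTopology henselianLocalRing

theorem Φ_mulVec_v₀_mul (h2 : IsUnit (2 : 𝒪[F])) (hϖ : IsUniformizer ϖ)
    (hθ : valuation F θ = 1) (ψ : AddChar F ℂ) (r : ℕ) (b : Fˣ) (x : F × F × F) :
    Φ ϖ θ r ((nMat x.1 x.2.1 x.2.2 * aMat (b * ϖ ^ r) * γ₀ F) *ᵥ v₀ θ) *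
        ψ (x.1 + 2 * θ * x.2.2) =
      ψ (-(2 * θ * (b * ϖ ^ r))) * (region (b : F) (2 * θ * (b * ϖ ^ r) ^ 2)).indicator
        (fun p => ψ (p.1 + 2 * θ * p.2.2)) (x + (0, 0, (b * ϖ ^ r : F))) := by
  have hx : x + (0, 0, (b * ϖ ^ r : F)) = (x.1, x.2.1, x.2.2 + b * ϖ ^ r) := by ext <;> simp
  rw [Φ_mulVec_v₀ h2 hϖ hθ, hx, ← Set.indicator_const_mul]
  have hψx : ψ (x.1 + 2 * θ * x.2.2) = ψ (-(2 * θ * (b * ϖ ^ r))) *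
      ψ (x.1 + 2 * θ * (x.2.2 + b * ϖ ^ r)) := by
    rw [← AddChar.map_add_eq_mul]
    ring_nf
  by_cases hmem : (x.1, x.2.1, x.2.2 + (b * ϖ ^ r : F)) ∈
      region (b : F) (2 * θ * (b * ϖ ^ r) ^ 2)
  · rw [Set.indicator_of_mem hmem, Set.indicator_of_mem hmem, Pi.one_apply, one_mul, hψx]
  · rw [Set.indicator_of_notMem hmem, Set.indicator_of_notMem hmem, zero_mul]

variable [MeasurableSpace F] [BorelSpace F] (μ : Measure F) [μ.IsAddHaarMeasure]

theorem integrable_orbInt (hψ : HasConductorIntegers ψ ϖ) (h2 : IsUnit (2 : 𝒪[F]))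
    (hϖ : IsUniformizer ϖ) (hθ : valuation F θ = 1) (r : ℕ) (α : Fˣ) :
    Integrable (fun x : F × F × F =>
      Φ ϖ θ r ((nMat x.1 x.2.1 x.2.2 * aMat α * γ₀ F) *ᵥ v₀ θ) * ψ (x.1 + 2 * θ * x.2.2))
      (μ.prod (μ.prod μ)) := by
  obtain ⟨b, rfl⟩ : ∃ b, α = b * ϖ ^ r := ⟨α * (ϖ ^ r)⁻¹, by simp⟩
  have := Measure.prod.instIsAddLeftInvariant (μ := μ) (ν := μ.prod μ)
  simp only [Φ_mulVec_v₀_mul h2 hϖ hθ]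
  exact (((integrable_indicator_iff (isCompact_region b.ne_zero _).measurableSet).2
    (integrableOn_region μ hψ b.ne_zero _ _)).comp_add_right _).const_mul _

theorem orbInt_eq_setIntegral_region (h2 : IsUnit (2 : 𝒪[F])) (hϖ : IsUniformizer ϖ)
    (hθ : valuation F θ = 1) (r : ℕ) (b : Fˣ) :
    orbInt μ ψ θ (Φ ϖ θ r) (b * ϖ ^ r) = ψ (-(2 * θ * (b * ϖ ^ r))) *
      ∫ p in region (b : F) (2 * θ * (b * ϖ ^ r) ^ 2), ψ (p.1 + 2 * θ * p.2.2)
        ∂(μ.prod (μ.prod μ)) := by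
  have := Measure.prod.instIsAddLeftInvariant (μ := μ) (ν := μ.prod μ)
  simp only [orbInt, Φ_mulVec_v₀_mul h2 hϖ hθ]
  rw [integral_const_mul, integral_add_right_eq_self (μ := μ.prod (μ.prod μ)),
    integral_indicator (isCompact_region b.ne_zero _).measurableSet]

theorem orbInt_of_valuation_lt_one (h2 : IsUnit (2 : 𝒪[F])) (hϖ : IsUniformizer ϖ)
    (hθ : valuation F θ = 1) (r : ℕ) {b : Fˣ} (hb : valuation F (b : F) < 1) :
    orbInt μ ψ θ (Φ ϖ θ r) (b * ϖ ^ r) = 0 := by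
  rw [orbInt_eq_setIntegral_region μ h2 hϖ hθ, region_eq_empty hb, setIntegral_empty, mul_zero]

theorem orbInt_of_valuation_eq_one (hψ : HasConductorIntegers ψ ϖ) (hμ : μ (ball (1 : F)) = 1)
    (h2 : IsUnit (2 : 𝒪[F])) (hϖ : IsUniformizer ϖ) (hθ : valuation F θ = 1) (r : ℕ)
    {b : Fˣ} (hb : valuation F (b : F) = 1) :
    orbInt μ ψ θ (Φ ϖ θ r) (b * ϖ ^ r) = 1 := by
  have hv2 : valuation F (2 : F) = 1 := isUnit_integer_iff.1 h2
  have h2θ : valuation F (2 * θ) = 1 := by rw [map_mul, hv2, hθ, one_mul]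
  have hα : valuation F (b * ϖ ^ r : F) ≤ 1 := by
    simpa [hb] using pow_le_one₀ zero_le hϖ.valuation_lt_one.le
  rw [orbInt_eq_setIntegral_region μ h2 hϖ hθ, hψ.map_eq_one, one_mul,
    setIntegral_region_eq_one μ hψ hμ hv2 h2θ.le hb]
  · rw [map_mul, h2θ, one_mul, map_pow]
    exact pow_le_one₀ zero_le hα
  · rwa [Valuation.map_neg, map_mul, h2θ, one_mul]

theorem orbInt_of_valuation_eq_inv (hψ : HasConductorIntegers ψ ϖ) (hμ : μ (ball (1 : F)) = 1)
    (h2 : IsUnit (2 : 𝒪[F])) (hϖ : IsUniformizer ϖ) (hθ : valuation F θ = 1)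
    (hθ' : ¬ IsSquare θ) (s : ℕ) {b : Fˣ} (hb : valuation F (b : F) = valuation F (ϖ : F)⁻¹) :
    orbInt μ ψ θ (Φ ϖ θ (s + 1)) (b * ϖ ^ (s + 1)) = -Nat.card 𝓀[F] := by
  have hv2 : valuation F (2 : F) = 1 := isUnit_integer_iff.1 h2
  have h2θ : valuation F (2 * θ) = 1 := by rw [map_mul, hv2, hθ, one_mul]
  have hα : valuation F (b * ϖ ^ (s + 1) : F) ≤ 1 := by
    rw [map_mul, hb, ← map_mul, pow_succ', inv_mul_cancel_left₀ ϖ.ne_zero, map_pow]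
    exact pow_le_one₀ zero_le hϖ.valuation_lt_one.le
  rw [orbInt_eq_setIntegral_region μ h2 hϖ hθ, hψ.map_eq_one, one_mul,
    setIntegral_region_eq_neg_card μ hϖ hψ hμ hv2
      (fun z hz => valuation_two_mul_sub_sq_div_two h2 hθ hθ' (by simpa using hz)) hb]
  · rw [map_mul, h2θ, one_mul, map_pow]
    exact (pow_le_one₀ zero_le hα).trans (hb ▸ hϖ.one_lt_valuation_inv).le
  · rwa [Valuation.map_neg, map_mul, h2θ, one_mul]

theorem orbInt_of_inv_lt_valuation (hψ : HasConductorIntegers ψ ϖ) (hμ : μ (ball (1 : F)) = 1)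
    (h2 : IsUnit (2 : 𝒪[F])) (hϖ : IsUniformizer ϖ) (hθ : valuation F θ = 1)
    (hθ' : ¬ IsSquare θ) (s : ℕ) {b : Fˣ} (hb : valuation F (ϖ : F)⁻¹ < valuation F (b : F)) :
    orbInt μ ψ θ (Φ ϖ θ (s + 1)) (b * ϖ ^ (s + 1)) = 0 := by
  have hv2 : valuation F (2 : F) = 1 := isUnit_integer_iff.1 h2
  rw [orbInt_eq_setIntegral_region μ h2 hϖ hθ, setIntegral_region_eq_zero μ hϖ hψ hμ hv2
    (fun z hz => valuation_two_mul_sub_sq_div_two h2 hθ hθ' (by simpa using hz)) hb, mul_zero]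
  calc valuation F (2 * θ * (b * ϖ ^ (s + 1)) ^ 2)
      = valuation F (ϖ : F) ^ ((s + 1) * 2) * valuation F (b : F) ^ 2 := by
        simp [hv2, hθ, mul_pow, mul_comm, pow_mul]
    _ ≤ valuation F (ϖ : F) * valuation F (b : F) ^ 2 :=
        mul_le_mul_left (pow_le_of_le_one zero_le hϖ.valuation_lt_one.le (by omega)) _

theorem orbInt_eq_indicator_shell (hψ : HasConductorIntegers ψ ϖ) (hμ : μ (ball (1 : F)) = 1)
    (h2 : IsUnit (2 : 𝒪[F])) (hϖ : IsUniformizer ϖ) (hθ : valuation F θ = 1)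
    (hθ' : ¬ IsSquare θ) (s : ℕ) (α : Fˣ) :
    orbInt μ ψ θ (Φ ϖ θ (s + 1)) α =
      (shell (ϖ ^ (s + 1))).indicator 1 α - Nat.card 𝓀[F] * (shell (ϖ ^ s)).indicator 1 α := by
  obtain ⟨b, rfl⟩ : ∃ b, α = b * ϖ ^ (s + 1) := ⟨α * (ϖ ^ (s + 1))⁻¹, by simp⟩
  have hone : b * ϖ ^ (s + 1) ∈ shell (ϖ ^ (s + 1)) ↔ valuation F (b : F) = 1 := by
    simp [shell]
  have hinv : b * ϖ ^ (s + 1) ∈ shell (ϖ ^ s) ↔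
      valuation F (b : F) = valuation F (ϖ : F)⁻¹ := by
    have hpow : ϖ ^ s = ϖ⁻¹ * ϖ ^ (s + 1) := by simp [pow_succ']
    simp [hpow, shell]
  have hlt := hϖ.one_lt_valuation_inv
  rcases lt_trichotomy (valuation F (b : F)) 1 with hb | hb | hb
  · rw [orbInt_of_valuation_lt_one μ h2 hϖ hθ _ hb, Set.indicator_of_notMem (hone.not.2 hb.ne),
      Set.indicator_of_notMem (hinv.not.2 (hb.trans hlt).ne), mul_zero, sub_zero]
  · rw [orbInt_of_valuation_eq_one μ hψ hμ h2 hϖ hθ _ hb, Set.indicator_of_mem (hone.2 hb),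
      Set.indicator_of_notMem (hinv.not.2 (hb.trans_lt hlt).ne), mul_zero, sub_zero, Pi.one_apply]
  rw [Set.indicator_of_notMem (hone.not.2 hb.ne'), zero_sub]
  rcases (hϖ.valuation_inv_le_of_one_lt hb).lt_or_eq with hb | hb
  · rw [orbInt_of_inv_lt_valuation μ hψ hμ h2 hϖ hθ hθ' _ hb,
      Set.indicator_of_notMem (hinv.not.2 hb.ne'), mul_zero, neg_zero]
  · rw [orbInt_of_valuation_eq_inv μ hψ hμ h2 hϖ hθ hθ' _ hb.symm,
      Set.indicator_of_mem (hinv.2 hb.symm), Pi.one_apply, mul_one]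

end OrbitalIntegral

section Mellin

variable {F : Type*} [Field F] [ValuativeRel F] [TopologicalSpace F] [IsNonarchimedeanLocalField F]

attribute [local instance] t2Space secondCountableTopology

theorem isCompact_shell (g : Fˣ) : IsCompact (shell g) := by
  have h := (isCompact_ball (g : F)).prod (MulOpposite.opHomeomorph.symm.isCompact_preimage.2
    (isCompact_ball ((g⁻¹ : Fˣ) : F)))
  convert Units.isClosedEmbedding_embedProduct.isCompact_preimage h using 1
  ext α
  simp [shell, Units.embedProduct, le_antisymm_iff,
    inv_le_inv₀ (valuation_pos α.ne_zero) (valuation_pos g.ne_zero)]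

variable [MeasurableSpace F] [BorelSpace F]

theorem borelSpace_units : BorelSpace Fˣ := by
  refine ⟨?_⟩
  change MeasurableSpace.comap Units.val _ = _
  rw [(Units.isEmbedding_val₀ (G₀ := F)).eq_induced, borel_comap,
    BorelSpace.measurable_eq (α := F)]

attribute [local instance] borelSpace_units

theorem measurableSet_shell (g : Fˣ) : MeasurableSet (shell g) :=
  (isCompact_shell g).measurableSet

variable (ν : Measure Fˣ) (μ : Measure F) [μ.IsAddHaarMeasure] {ψ : AddChar F ℂ}
  {ϖ : Fˣ} {θ : F}

theorem orbInt_mul_eq_indicator_shell (hψ : HasConductorIntegers ψ ϖ) (hμ : μ (ball (1 : F)) = 1)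
    (h2 : IsUnit (2 : 𝒪[F])) (hϖ : IsUniformizer ϖ) (hθ : valuation F θ = 1)
    (hθ' : ¬ IsSquare θ) (s : ℕ) (f : Fˣ → ℂ) (α : Fˣ) :
    orbInt μ ψ θ (Φ ϖ θ (s + 1)) α * f α =
      (shell (ϖ ^ (s + 1))).indicator f α - Nat.card 𝓀[F] * (shell (ϖ ^ s)).indicator f α := by
  rw [orbInt_eq_indicator_shell μ hψ hμ h2 hϖ hθ hθ', sub_mul, mul_assoc,
    ← Set.indicator_mul_left, ← Set.indicator_mul_left]
  simp only [Pi.one_apply, one_mul]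

theorem integrable_orbInt_mul (hψ : HasConductorIntegers ψ ϖ) (hμ : μ (ball (1 : F)) = 1)
    (h2 : IsUnit (2 : 𝒪[F])) (hϖ : IsUniformizer ϖ) (hθ : valuation F θ = 1)
    (hθ' : ¬ IsSquare θ) (s : ℕ) {f : Fˣ → ℂ} (hf : ∀ g, IntegrableOn f (shell g) ν) :
    Integrable (fun α => orbInt μ ψ θ (Φ ϖ θ (s + 1)) α * f α) ν := by
  have hind (g : Fˣ) := (integrable_indicator_iff (measurableSet_shell g)).2 (hf g)
  simp only [orbInt_mul_eq_indicator_shell μ hψ hμ h2 hϖ hθ hθ']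
  exact (hind _).sub ((hind _).const_mul _)

theorem integral_orbInt_mul (hψ : HasConductorIntegers ψ ϖ) (hμ : μ (ball (1 : F)) = 1)
    (h2 : IsUnit (2 : 𝒪[F])) (hϖ : IsUniformizer ϖ) (hθ : valuation F θ = 1)
    (hθ' : ¬ IsSquare θ) (s : ℕ) {f : Fˣ → ℂ} (hf : ∀ g, IntegrableOn f (shell g) ν) :
    ∫ α, orbInt μ ψ θ (Φ ϖ θ (s + 1)) α * f α ∂ν =
      ∫ α in shell (ϖ ^ (s + 1)), f α ∂ν - Nat.card 𝓀[F] * ∫ α in shell (ϖ ^ s), f α ∂ν := by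
  have hind (g : Fˣ) := (integrable_indicator_iff (measurableSet_shell g)).2 (hf g)
  simp only [orbInt_mul_eq_indicator_shell μ hψ hμ h2 hϖ hθ hθ']
  rw [integral_sub (hind _) ((hind _).const_mul _), integral_const_mul,
    integral_indicator (measurableSet_shell _), integral_indicator (measurableSet_shell _)]

variable [ν.IsHaarMeasure] {χ : Fˣ →* ℂˣ}

theorem integrableOn_shell (hχ : Continuous χ) (g : Fˣ) :
    IntegrableOn (fun α => (χ α : ℂ)) (shell g) ν :=
  (Units.continuous_val.comp hχ).continuousOn.integrableOn_compact (isCompact_shell g)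

theorem IsUnramified.setIntegral_shell (hχ : IsUnramified χ) (hν : ν (integerUnits F) = 1)
    (g : Fˣ) : ∫ α in shell g, (χ α : ℂ) ∂ν = χ g := by
  have hconst : Set.EqOn (fun α => (χ α : ℂ)) (fun _ => (χ g : ℂ)) (shell g) := fun α hα => by
    have hunit : α / g ∈ integerUnits F := by
      simp [integerUnits, div_eq_mul_inv, hα.out]
    simpa using congr_arg Units.val (congr_arg (· * χ g) (hχ _ hunit))
  rw [setIntegral_congr_fun (measurableSet_shell g) hconst]
  simp [measureReal_def, measure_shell, hν]

theorem setIntegral_shell_eq_zero (hχ : ¬ IsUnramified χ) (g : Fˣ) :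
    ∫ α in shell g, (χ α : ℂ) ∂ν = 0 := by
  simp only [IsUnramified, not_forall] at hχ
  obtain ⟨u, hu, hχu⟩ := hχ
  refine setIntegral_eq_zero_of_mul_left ν (measurableSet_shell g) (g := u) (c := χ u)
    (fun α => ?_) (fun h => hχu (Units.ext h)) fun α _ => by rw [map_mul, Units.val_mul]
  simp [shell, hu.out]

end Mellin

end SOFive

theorem proposition3p6 {F : Type*} [Field F] [ValuativeRel F] [TopologicalSpace F]
    [IsNonarchimedeanLocalField F] [MeasurableSpace F] [BorelSpace F]
    (hchar : ringChar 𝓀[F] ≠ 2)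
    (ϖ : Fˣ) (hϖ : SOFive.IsUniformizer ϖ)
    (ψ : AddChar F ℂ) (hψ : SOFive.HasConductorIntegers ψ ϖ)
    -- the additive measure `dx` and the multiplicative measure `d^×x`
    (μ : Measure F) [μ.IsAddHaarMeasure] (hμ : μ (𝒪[F] : Set F) = 1)
    (ν : Measure Fˣ) [ν.IsHaarMeasure] (hν : ν (SOFive.integerUnits F) = 1)
    (θ : F) (hθ : valuation F θ = 1) (hθ' : ¬ IsSquare θ)
    (r : ℕ) (hr : 1 ≤ r)
    (χ : Fˣ →* ℂˣ) (hχ : Continuous χ) :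
    (∀ α : Fˣ, Integrable (fun x : F × F × F =>
      SOFive.Φ ϖ θ r
        ((SOFive.nMat x.1 x.2.1 x.2.2 * SOFive.aMat α * SOFive.γ₀ F) *ᵥ SOFive.v₀ θ) *
        ψ (x.1 + 2 * θ * x.2.2)) (μ.prod (μ.prod μ))) ∧
    Integrable (fun α : Fˣ => SOFive.orbInt μ ψ θ (SOFive.Φ ϖ θ r) α * (χ α : ℂ)) ν ∧
    (SOFive.IsUnramified χ → ∀ X : ℂ, X = ((χ ϖ : ℂˣ) : ℂ)⁻¹ →
      ∫ α : Fˣ, SOFive.orbInt μ ψ θ (SOFive.Φ ϖ θ r) α * (χ α : ℂ) ∂ν =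
        X ^ (-(r : ℤ)) - (Nat.card 𝓀[F] : ℂ) * X ^ (1 - (r : ℤ))) ∧
    (¬ SOFive.IsUnramified χ →
      ∫ α : Fˣ, SOFive.orbInt μ ψ θ (SOFive.Φ ϖ θ r) α * (χ α : ℂ) ∂ν = 0) := by
  have h2 := SOFive.isUnit_two_integer hchar
  rw [← SOFive.coe_ball_one] at hμ
  obtain ⟨s, rfl⟩ : ∃ s, r = s + 1 := ⟨r - 1, by omega⟩
  have hint := SOFive.integrableOn_shell ν hχ
  have hmellin := SOFive.integral_orbInt_mul ν μ hψ hμ h2 hϖ hθ hθ' s hint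
  refine ⟨SOFive.integrable_orbInt μ hψ h2 hϖ hθ _,
    SOFive.integrable_orbInt_mul ν μ hψ hμ h2 hϖ hθ hθ' s hint, ?_, fun hram => ?_⟩
  · rintro hun X rfl
    have hexp : (1 : ℤ) - (s + 1 : ℕ) = -s := by push_cast; ring
    rw [hmellin, hun.setIntegral_shell ν hν, hun.setIntegral_shell ν hν, hexp, inv_zpow', inv_zpow',
      neg_neg, neg_neg, zpow_natCast, zpow_natCast, map_pow, map_pow, Units.val_pow_eq_pow_val,
      Units.val_pow_eq_pow_val]
  · rw [hmellin, SOFive.setIntegral_shell_eq_zero ν hram, SOFive.setIntegral_shell_eq_zero ν hram,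
      mul_zero, sub_zero]
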